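/- Setting. Let $x_1,\dots,x_n\in\mathbb R^d$, $y\in\mathbb R^n$, and assume that the set of interpolators $\mathcal S=\{\beta\in\mathbb R^d:\langle\beta,x_i\rangle=y_i\ \forall i\in[n]\}$ is non-empty. For a batch $\mathcal B\subset[n]$ of size $b$ ($1\le b\le n$) put $\mathcal L_{\mathcal B}(\beta)=\frac1{2b}\sum_{i\in\mathcal B}(\langle\beta,x_i\rangle-y_i)^2$ and $H_{\mathcal B}=\frac1b\sum_{i\in\mathcal B}x_ix_i^\top$, and let $L>0$ be such that $\|H_{\mathcal B}\beta\|_2\le L\|\beta\|_2$ and $\|H_{\mathcal B}\beta\|_\infty\le L\|\beta\|_\infty$ for all $\beta\in\mathbb R^d$ and all batches $\mathcal B$ of size $b$. Given $\alpha\in\mathbb R^d_{>0}$ and deterministic stepsizes $\gamma_k\ge0$, let $w_k=(u_k,v_k)\in\mathbb R^{2d}$ follow minibatch SGD on the diagonal linear network, $w_{k+1}=w_k-\gamma_k\nabla F_{\mathcal B_k}(w_k)$ with $F_{\mathcal B}(u,v)=\mathcal L_{\mathcal B}(u\odot v)$, started at $u_0=\sqrt2\,\alpha$, $v_0=0$,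 where the batches $\mathcal B_k$ are independent and uniform among the subsets of $[n]$ of size $b$ (gradient descent is the case $b=n$). Let $\beta_k=u_k\odot v_k$ and $g_k=\gamma_k\nabla\mathcal L_{\mathcal B_k}(\beta_k)$. Functions of vectors, products, powers and inequalities are coordinatewise. Let $q(z)=-\frac12\ln((1-z^2)^2)$, which is $\ge0$ for $|z|\le\sqrt2$ (with $q(\pm1)=+\infty$), and $q_\pm(z)=\mp2z-\ln((1\mp z)^2)$. Let $$\psi_\alpha(\beta)=\tfrac12\sum_{i=1}^d\Big(\beta_i\,\mathrm{arcsinh}\big(\tfrac{\beta_i}{\alpha_i^2}\big)-\sqrt{\beta_i^2+\alpha_i^4}+\alpha_i^2\Big),\qquad D_h(\beta,\beta')=h(\beta)-h(\beta')-\langle\nabla h(\beta'),\beta-\beta'\rangle .$$ Theorem. There is a numerical constant $c>0$, and for all $x_1,\dots,x_n$, $y$ and $\alpha$ as above there is $B>0$ (depending only on these), such that for all $b$, all $L$ and all stepsizes with $0\le\gamma_k\le\frac{c}{LB}$ for every $k$: 0. $\|\gamma_k\nabla\mathcal L_{\mathcal B_k}(\beta_k)\|_\infty<1$ and $\|\beta_k\|_\infty\le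 B$ for all $k$, for every realisation of the batches. If moreover $\sum_k\gamma_k=\infty$ (for instance if the stepsizes are bounded below by a positive constant), then almost surely: 1. $\beta_k$ converges to some $\beta^\star_\infty\in\mathcal S$, and $\beta^\star_\infty$ is the unique minimiser over $\beta^\star\in\mathcal S$ of $D_{\psi_{\alpha_\infty}}(\beta^\star,\tilde\beta_0)$, with $\alpha_\infty\in\mathbb R^d_{>0}$ and $\tilde\beta_0\in\mathbb R^d$ as follows. 2. The series $\sum_kq(g_k)$ and $\sum_kq_\pm(g_k)$ converge, $\alpha_\infty\le\alpha$, $$\alpha_\infty^2=\alpha^2\odot\exp\Big(-\sum_{k=0}^\infty q(g_k)\Big),\qquad \tilde\beta_0=\tfrac12\big(\alpha_+^2-\alpha_-^2\big),\qquad \alpha_\pm^2=\alpha^2\odot\exp\Big(-\sum_{k=0}^\infty q_\pm(g_k)\Big).$$ -/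

import Mathlib

open MeasureTheory ProbabilityTheory Filter Topology

noncomputable section

namespace DLN

/-- `ℝ^d` with its Euclidean structure. -/
abbrev Vec (d : ℕ) : Type := EuclideanSpace ℝ (Fin d)

/-- The parameter space `ℝ^{2d}` of pairs `w = (u, v)`, with its Euclidean structure. -/
abbrev Param (d : ℕ) : Type := WithLp 2 (Vec d × Vec d)

/-- The `ℓ_∞` norm of a vector (the norm of the Pi type is the sup norm). -/
def supNorm {d : ℕ} (v : Vec d) : ℝ := ‖WithLp.ofLp v‖

/-- The coordinatewise product `u ⊙ v`. -/
def hadamard {d : ℕ} (u v : Vec d) : Vec d := WithLp.toLp 2 fun i => u i * v i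

/-- The set of interpolators `{β | ⟨β, x_i⟩ = y_i for all i}`. -/
def interpolators {n d : ℕ} (x : Fin n → Vec d) (y : Fin n → ℝ) : Set (Vec d) :=
  {β | ∀ i, inner ℝ β (x i) = y i}

/-- The batch loss `(1 / (2|s|)) ∑_{i ∈ s} (⟨β, x_i⟩ - y_i)²`. -/
def batchLoss {n d : ℕ} (x : Fin n → Vec d) (y : Fin n → ℝ) (s : Finset (Fin n))
    (β : Vec d) : ℝ :=
  1 / (2 * (s.card : ℝ)) * ∑ i ∈ s, (inner ℝ β (x i) - y i) ^ 2

/-- The batch loss of the two-layer diagonal linear network, as a function of `w = (u, v)`. -/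
def netLoss {n d : ℕ} (x : Fin n → Vec d) (y : Fin n → ℝ) (s : Finset (Fin n))
    (w : Param d) : ℝ :=
  batchLoss x y s (hadamard w.fst w.snd)

/-- The batch Hessian `(1/|s|) ∑_{i ∈ s} x_i x_iᵀ`. -/
def batchHessian {n d : ℕ} (x : Fin n → Vec d) (s : Finset (Fin n)) :
    Matrix (Fin d) (Fin d) ℝ :=
  (s.card : ℝ)⁻¹ • ∑ i ∈ s, Matrix.vecMulVec (WithLp.ofLp (x i)) (WithLp.ofLp (x i))

/-- `L` is a smoothness constant for batches of size `b`: it bounds every batch Hessian both in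
the `ℓ_2` and in the `ℓ_∞` operator norm. -/
def IsSmoothnessConstant {n d : ℕ} (x : Fin n → Vec d) (b : ℕ) (L : ℝ) : Prop :=
  ∀ s : Finset (Fin n), s.card = b → ∀ v : Fin d → ℝ,
    ‖WithLp.toLp 2 (Matrix.mulVec (batchHessian x s) v)‖ ≤ L * ‖WithLp.toLp 2 v‖ ∧
    ‖Matrix.mulVec (batchHessian x s) v‖ ≤ L * ‖v‖

/-- Minibatch SGD on the network loss with stepsizes `γ`, along the batch sequence `s`, started at
`u₀ = √2 α`, `v₀ = 0`. -/
def sgd {n d : ℕ} (x : Fin n → Vec d) (y : Fin n → ℝ) (α : Vec d) (γ : ℕ → ℝ)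
    (s : ℕ → Finset (Fin n)) : ℕ → Param d
  | 0 => WithLp.toLp 2 (√2 • α, 0)
  | k + 1 => sgd x y α γ s k - γ k • gradient (netLoss x y (s k)) (sgd x y α γ s k)

/-- The prediction parameter `β_k = u_k ⊙ v_k`. -/
def predictor {n d : ℕ} (x : Fin n → Vec d) (y : Fin n → ℝ) (α : Vec d) (γ : ℕ → ℝ)
    (s : ℕ → Finset (Fin n)) (k : ℕ) : Vec d :=
  hadamard (sgd x y α γ s k).fst (sgd x y α γ s k).snd

/-- The scaled stochastic gradient `γ_k ∇L_{s_k}(β_k)`. -/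
def scaledGrad {n d : ℕ} (x : Fin n → Vec d) (y : Fin n → ℝ) (α : Vec d) (γ : ℕ → ℝ)
    (s : ℕ → Finset (Fin n)) (k : ℕ) : Vec d :=
  γ k • gradient (batchLoss x y (s k)) (predictor x y α γ s k)

/-- Batches of `b` distinct samples. -/
structure Batch (n b : ℕ) where
  /-- The set of sampled indices. -/
  idx : Finset (Fin n)
  card_idx : idx.card = b

/-- Batches form a finite set, which carries the discrete σ-algebra. -/
instance instMeasurableSpaceBatch (n b : ℕ) : MeasurableSpace (Batch n b) := ⊤

/-- The batches are sampled independently, and uniformly among the `n.choose b` batches of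
size `b`. -/
structure IsUniformSampling {n b : ℕ} {Ω : Type*} [MeasurableSpace Ω] (P : Measure Ω)
    (batch : ℕ → Ω → Batch n b) : Prop where
  measurable : ∀ k, Measurable (batch k)
  indep : iIndepFun batch P
  uniform : ∀ k (s : Batch n b), P {ω | batch k ω = s} = ((n.choose b : ℕ) : ENNReal)⁻¹

/-- The hyperbolic entropy of scale `α`. -/
def hypEntropy {d : ℕ} (α β : Vec d) : ℝ :=
  1 / 2 * ∑ i, (β i * Real.arsinh (β i / α i ^ 2) - √(β i ^ 2 + α i ^ 4) + α i ^ 2)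

/-- The Bregman divergence `D_h(β, β')`. -/
def bregman {d : ℕ} (h : Vec d → ℝ) (β β' : Vec d) : ℝ :=
  h β - h β' - inner ℝ (gradient h β') (β - β')

/-- `q(z) = -½ ln((1 - z²)²)`. It is used below for `|z| < 1` only, where the logarithm is
genuine. -/
def q (z : ℝ) : ℝ := -(1 / 2) * Real.log ((1 - z ^ 2) ^ 2)

/-- `q₊(z) = -2z - ln((1 - z)²)`. -/
def qPlus (z : ℝ) : ℝ := -2 * z - Real.log ((1 - z) ^ 2)

/-- `q₋(z) = 2z - ln((1 + z)²)`. -/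
def qMinus (z : ℝ) : ℝ := 2 * z - Real.log ((1 + z) ^ 2)

/-- The `i`-th coordinate of `α² ⊙ exp(-∑_k f(g_k))`. -/
def effectiveSq {d : ℕ} (f : ℝ → ℝ) (α : Vec d) (g : ℕ → Vec d) (i : Fin d) : ℝ :=
  α i ^ 2 * Real.exp (-∑' k, f (g k i))

/-- The set of minimisers of `f` over `S`. -/
def argminOn {d : ℕ} (f : Vec d → ℝ) (S : Set (Vec d)) : Set (Vec d) :=
  {β | β ∈ S ∧ IsMinOn f S β}

end DLN

end

open DLN

/-! ### Gradients of the losses -/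

namespace DLN

/-! In the coordinates `a = (u + v)² / 2`, `b = (u - v)² / 2` one SGD step is multiplicative: `a` is
multiplied by `(1 - g)²` and `b` by `(1 + g)²`, with `β = (a - b) / 2`. This is an
exponentiated-gradient scheme up to second order in `g`, so relative entropy is its natural Lyapunov
function. For positive `p`, `r` with `(p - r) / 2` interpolating, a step changes the entropy of `(a,
b)` relative to `(p, r)` by at most `-8 γ ℓ` (first order) plus a multiple of `‖g‖²`. Since the
batch residuals vanish at an interpolator, `‖g‖² ≤ 2 L γ² ℓ`, so small steps give descent for every
batch (`lyapunov_succ_le`). Hence `a`, `b` stay in a fixed box away from `0`, and `∑ γ ℓ` and `∑ g²`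
are bounded (`exists_isControlled`).

Each batch is independent of the past, so averaging the energy bound shows that the loss over all
batches is almost surely summable against `γ` (`ae_summable_totalLoss`). As `∑ γ` diverges, some
subsequence of `(a, b)` tends to a point `(p, r)` over an interpolator. The entropy relative to this
very point is nonincreasing and vanishes along the subsequence, so the whole sequence converges
(`IsControlled.tendsto`).

For the bias, taking logarithms of the products separates `∑ g` from `∑ q±(g)`. In the limit, the
mirror gradients at the limit and at `β̃₀` differ by `-∑ g`. This is orthogonal to differences of
interpolators, which is the optimality condition of the Bregman projection
(`IsControlled.implicit_bias`). -/

/-- The gradient of the batch loss. -/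
noncomputable def batchGrad {n d : ℕ} (x : Fin n → Vec d) (y : Fin n → ℝ) (s : Finset (Fin n))
    (β : Vec d) : Vec d :=
  (s.card : ℝ)⁻¹ • ∑ i ∈ s, (inner ℝ β (x i) - y i) • x i

theorem hasGradientAt_batchLoss {n d : ℕ} (x : Fin n → Vec d) (y : Fin n → ℝ)
    (s : Finset (Fin n)) (β : Vec d) :
    HasGradientAt (batchLoss x y s) (batchGrad x y s β) β := by
  rw [hasGradientAt_iff_hasFDerivAt]
  have h1 : ∀ i ∈ s, HasFDerivAt (fun β : Vec d => (inner ℝ β (x i) - y i) ^ 2)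
      ((2 * (inner ℝ β (x i) - y i)) • innerSL ℝ (x i)) β := by
    intro i _
    have h : HasFDerivAt (fun β : Vec d => inner ℝ β (x i) - y i) (innerSL ℝ (x i)) β := by
      have := ((innerSL ℝ (x i)).hasFDerivAt (x := β)).sub_const (y i)
      refine this.congr_of_eventuallyEq (Eventually.of_forall fun z => ?_)
      simp [real_inner_comm]
    exact (h.pow 2).congr_fderiv (by ext; simp)
  have h2 := (HasFDerivAt.fun_sum h1).const_mul (1 / (2 * (s.card : ℝ)))
  refine h2.congr_fderiv ?_
  ext z
  simp only [batchGrad, smul_apply, sum_apply,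
    innerSL_apply_apply, smul_eq_mul, InnerProductSpace.toDual_apply_apply, inner_smul_left,
    sum_inner, Finset.mul_sum, RCLike.conj_to_real]
  refine Finset.sum_congr rfl fun i _ => ?_
  rw [one_div, mul_inv]
  ring

theorem gradient_batchLoss {n d : ℕ} (x : Fin n → Vec d) (y : Fin n → ℝ)
    (s : Finset (Fin n)) (β : Vec d) :
    gradient (batchLoss x y s) β = batchGrad x y s β :=
  (hasGradientAt_batchLoss x y s β).gradient

theorem hasFDerivAt_hadamard {d : ℕ} (w : Param d) :
    ∃ D : Param d →L[ℝ] Vec d,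
      HasFDerivAt (fun w : Param d => hadamard w.fst w.snd) D w ∧
      ∀ z i, D z i = w.fst i * z.snd i + w.snd i * z.fst i := by
  let p : Fin d → (Param d →L[ℝ] ℝ) := fun i =>
    (EuclideanSpace.proj i : Vec d →L[ℝ] ℝ) ∘L (WithLp.fstL 2 ℝ (Vec d) (Vec d))
  let q : Fin d → (Param d →L[ℝ] ℝ) := fun i =>
    (EuclideanSpace.proj i : Vec d →L[ℝ] ℝ) ∘L (WithLp.sndL 2 ℝ (Vec d) (Vec d))
  let e := (PiLp.continuousLinearEquiv 2 ℝ (fun _ : Fin d => ℝ)).symm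
  refine ⟨(e : (Fin d → ℝ) →L[ℝ] Vec d) ∘L
    ContinuousLinearMap.pi fun i => p i w • q i + q i w • p i, ?_, fun z i => ?_⟩
  · have : HasFDerivAt (fun w : Param d => fun i => p i w * q i w)
        (ContinuousLinearMap.pi fun i => p i w • q i + q i w • p i) w :=
      hasFDerivAt_pi.2 fun i => (p i).hasFDerivAt.mul (q i).hasFDerivAt
    exact e.hasFDerivAt.comp w this
  · rfl

theorem gradient_netLoss {n d : ℕ} (x : Fin n → Vec d) (y : Fin n → ℝ)
    (s : Finset (Fin n)) (w : Param d) :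
    gradient (netLoss x y s) w =
      WithLp.toLp 2 (hadamard (batchGrad x y s (hadamard w.fst w.snd)) w.snd,
        hadamard (batchGrad x y s (hadamard w.fst w.snd)) w.fst) := by
  refine HasGradientAt.gradient ?_
  rw [hasGradientAt_iff_hasFDerivAt]
  obtain ⟨D, hD, hDz⟩ := hasFDerivAt_hadamard w
  have h := (hasGradientAt_batchLoss x y s (hadamard w.fst w.snd)).hasFDerivAt.comp w hD
  refine HasFDerivAt.congr_fderiv (f := netLoss x y s) h ?_
  ext z
  simp only [ContinuousLinearMap.comp_apply, InnerProductSpace.toDual_apply_apply,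
    WithLp.prod_inner_apply, PiLp.inner_apply, hDz, hadamard, ← Finset.sum_add_distrib]
  refine Finset.sum_congr rfl fun i _ => ?_
  simp
  ring

theorem scaledGrad_eq {n d : ℕ} (x : Fin n → Vec d) (y : Fin n → ℝ) (α : Vec d) (γ : ℕ → ℝ)
    (s : ℕ → Finset (Fin n)) (k : ℕ) :
    scaledGrad x y α γ s k = γ k • batchGrad x y (s k) (predictor x y α γ s k) := by
  rw [scaledGrad, gradient_batchLoss]

/-! ### Multiplicative form of the recursion -/

/-- The squared coordinates `½ (u + v)²` of the iterates. -/
noncomputable def plusSq {n d : ℕ} (x : Fin n → Vec d) (y : Fin n → ℝ) (α : Vec d) (γ : ℕ → ℝ)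
    (s : ℕ → Finset (Fin n)) (k : ℕ) (i : Fin d) : ℝ :=
  ((sgd x y α γ s k).fst i + (sgd x y α γ s k).snd i) ^ 2 / 2

/-- The squared coordinates `½ (u - v)²` of the iterates. -/
noncomputable def minusSq {n d : ℕ} (x : Fin n → Vec d) (y : Fin n → ℝ) (α : Vec d) (γ : ℕ → ℝ)
    (s : ℕ → Finset (Fin n)) (k : ℕ) (i : Fin d) : ℝ :=
  ((sgd x y α γ s k).fst i - (sgd x y α γ s k).snd i) ^ 2 / 2

section Recursion

variable {n d : ℕ} (x : Fin n → Vec d) (y : Fin n → ℝ) (α : Vec d) (γ : ℕ → ℝ)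
  (s : ℕ → Finset (Fin n))

theorem sgd_succ_fst (k : ℕ) (i : Fin d) :
    (sgd x y α γ s (k + 1)).fst i = (sgd x y α γ s k).fst i
      - scaledGrad x y α γ s k i * (sgd x y α γ s k).snd i := by
  rw [scaledGrad_eq, sgd, gradient_netLoss]
  simp [hadamard, predictor]
  ring

theorem sgd_succ_snd (k : ℕ) (i : Fin d) :
    (sgd x y α γ s (k + 1)).snd i = (sgd x y α γ s k).snd i
      - scaledGrad x y α γ s k i * (sgd x y α γ s k).fst i := by
  rw [scaledGrad_eq, sgd, gradient_netLoss]
  simp [hadamard, predictor]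
  ring

theorem plusSq_zero (i : Fin d) : plusSq x y α γ s 0 i = α i ^ 2 := by
  simp [plusSq, sgd, mul_pow]

theorem minusSq_zero (i : Fin d) : minusSq x y α γ s 0 i = α i ^ 2 := by
  simp [minusSq, sgd, mul_pow]

/-- The step acts on each pair `(u i, v i)` by a symmetric matrix whose eigenvectors are `u ± v`,
with eigenvalues `1 ∓ g`. -/
theorem plusSq_succ (k : ℕ) (i : Fin d) :
    plusSq x y α γ s (k + 1) i = plusSq x y α γ s k i * (1 - scaledGrad x y α γ s k i) ^ 2 := by
  rw [plusSq, plusSq, sgd_succ_fst, sgd_succ_snd]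
  ring

theorem minusSq_succ (k : ℕ) (i : Fin d) :
    minusSq x y α γ s (k + 1) i
      = minusSq x y α γ s k i * (1 + scaledGrad x y α γ s k i) ^ 2 := by
  rw [minusSq, minusSq, sgd_succ_fst, sgd_succ_snd]
  ring

theorem predictor_apply (k : ℕ) (i : Fin d) :
    predictor x y α γ s k i = (plusSq x y α γ s k i - minusSq x y α γ s k i) / 2 := by
  simp only [predictor, hadamard, plusSq, minusSq]
  ring

/-- Non-anticipation: this is what makes the iterate independent of the batch drawn next. -/
theorem sgd_congr {s t : ℕ → Finset (Fin n)} (k : ℕ) (h : ∀ j < k, s j = t j) :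
    sgd x y α γ s k = sgd x y α γ t k := by
  induction k with
  | zero => rfl
  | succ k ih => rw [sgd, sgd, ih fun j hj => h j (hj.trans k.lt_succ_self), h k k.lt_succ_self]

end Recursion

/-! ### Batch losses in the interpolating regime -/

section BatchLoss

variable {n d : ℕ} {x : Fin n → Vec d} {y : Fin n → ℝ}

theorem batchLoss_nonneg (s : Finset (Fin n)) (β : Vec d) : 0 ≤ batchLoss x y s β := by
  unfold batchLoss
  positivity

theorem continuous_batchLoss (s : Finset (Fin n)) : Continuous (batchLoss x y s) := by
  unfold batchLoss
  fun_prop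

theorem inner_eq_of_batchLoss_eq_zero {s : Finset (Fin n)} {β : Vec d}
    (h : batchLoss x y s β = 0) {i : Fin n} (hi : i ∈ s) : inner ℝ β (x i) = y i := by
  have hs : (0 : ℝ) < s.card := by exact_mod_cast Finset.card_pos.2 ⟨i, hi⟩
  rw [batchLoss, mul_eq_zero, Finset.sum_eq_zero_iff_of_nonneg fun _ _ => sq_nonneg _] at h
  rcases h with h | h
  · exact absurd h (by positivity)
  · exact sub_eq_zero.1 (pow_eq_zero_iff two_ne_zero |>.1 (h i hi))

theorem inner_batchGrad (s : Finset (Fin n)) (β z : Vec d) :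
    inner ℝ (batchGrad x y s β) z
      = (s.card : ℝ)⁻¹ * ∑ i ∈ s, (inner ℝ β (x i) - y i) * inner ℝ (x i) z := by
  simp [batchGrad, inner_smul_left, sum_inner]

theorem inner_batchGrad_sub_eq_zero (s : Finset (Fin n)) (β : Vec d) {z z' : Vec d}
    (hz : z ∈ interpolators x y) (hz' : z' ∈ interpolators x y) :
    inner ℝ (batchGrad x y s β) (z - z') = 0 := by
  rw [inner_batchGrad]
  refine mul_eq_zero_of_right _ (Finset.sum_eq_zero fun i _ => ?_)
  rw [real_inner_comm (z - z') (x i), inner_sub_left, hz i, hz' i]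
  ring

theorem inner_batchGrad_sub (s : Finset (Fin n)) (β : Vec d) {z : Vec d}
    (hz : z ∈ interpolators x y) :
    inner ℝ (batchGrad x y s β) (z - β) = -(2 * batchLoss x y s β) := by
  rw [inner_batchGrad, batchLoss, Finset.mul_sum, Finset.mul_sum, Finset.mul_sum,
    ← Finset.sum_neg_distrib]
  refine Finset.sum_congr rfl fun i _ => ?_
  rw [real_inner_comm (z - β) (x i), inner_sub_left, hz i, one_div, mul_inv]
  ring

theorem batchGrad_eq_mulVec (s : Finset (Fin n)) (β : Vec d) {z : Vec d}
    (hz : z ∈ interpolators x y) :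
    WithLp.ofLp (batchGrad x y s β)
      = Matrix.mulVec (batchHessian x s) (WithLp.ofLp (β - z)) := by
  ext j
  rw [batchHessian, Matrix.smul_mulVec, Matrix.sum_mulVec]
  simp only [batchGrad, PiLp.smul_apply, WithLp.ofLp_sum, Finset.sum_apply, Pi.smul_apply,
    WithLp.ofLp_smul, smul_eq_mul]
  congr 1
  refine Finset.sum_congr rfl fun i _ => ?_
  rw [← hz i, ← inner_sub_left, Matrix.vecMulVec_mulVec]
  simp [PiLp.inner_apply, dotProduct, mul_comm]

/-- Cauchy–Schwarz between the residuals and the numbers `⟨x i, G⟩` bounds `‖G‖⁴` by twice the loss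
times the quadratic form of the Hessian at `G`, which is at most `L ‖G‖²`. -/
theorem norm_batchGrad_sq_le {b : ℕ} {L : ℝ} (hL : IsSmoothnessConstant x b L)
    {s : Finset (Fin n)} (hs : s.card = b) (β : Vec d) {z : Vec d}
    (hz : z ∈ interpolators x y) :
    ‖batchGrad x y s β‖ ^ 2 ≤ 2 * L * batchLoss x y s β := by
  set G := batchGrad x y s β with hG
  -- With zero labels the origin interpolates, so the gradient at `G` is the Hessian applied to `G`.
  have hGG : WithLp.ofLp (batchGrad x (fun _ => 0) s G)
      = Matrix.mulVec (batchHessian x s) (WithLp.ofLp G) := by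
    have := batchGrad_eq_mulVec (x := x) (y := fun _ => 0) s G (z := 0) (by simp [interpolators])
    simpa using this
  have hnorm : ‖batchGrad x (fun _ => 0) s G‖ ≤ L * ‖G‖ := by
    have := (hL s hs (WithLp.ofLp G)).1
    rwa [← hGG] at this
  have h1 : ‖G‖ ^ 2 = (s.card : ℝ)⁻¹ * ∑ i ∈ s, (inner ℝ β (x i) - y i) * inner ℝ (x i) G := by
    rw [← real_inner_self_eq_norm_sq, ← inner_batchGrad]
  have h2 : (s.card : ℝ)⁻¹ * ∑ i ∈ s, (inner ℝ (x i) G) ^ 2 ≤ L * ‖G‖ ^ 2 := by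
    have : (s.card : ℝ)⁻¹ * ∑ i ∈ s, (inner ℝ (x i) G) ^ 2
        = inner ℝ (batchGrad x (fun _ => 0) s G) G := by
      rw [inner_batchGrad]
      congr 1
      refine Finset.sum_congr rfl fun i _ => ?_
      rw [real_inner_comm G (x i)]
      ring
    rw [this]
    refine (real_inner_le_norm _ _).trans ?_
    nlinarith [norm_nonneg G]
  have h3 := Finset.sum_mul_sq_le_sq_mul_sq s (fun i => inner ℝ β (x i) - y i)
    (fun i => inner ℝ (x i) G)
  have h4 : (s.card : ℝ)⁻¹ * ∑ i ∈ s, (inner ℝ β (x i) - y i) ^ 2 = 2 * batchLoss x y s β := by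
    rw [batchLoss, one_div, mul_inv]
    ring
  have h5 : (‖G‖ ^ 2) ^ 2 ≤ (2 * batchLoss x y s β) * (L * ‖G‖ ^ 2) := by
    calc (‖G‖ ^ 2) ^ 2 = (s.card : ℝ)⁻¹ ^ 2 *
          (∑ i ∈ s, (inner ℝ β (x i) - y i) * inner ℝ (x i) G) ^ 2 := by rw [h1]; ring
      _ ≤ (s.card : ℝ)⁻¹ ^ 2 * ((∑ i ∈ s, (inner ℝ β (x i) - y i) ^ 2) *
          ∑ i ∈ s, (inner ℝ (x i) G) ^ 2) := by gcongr
      _ = (2 * batchLoss x y s β) * ((s.card : ℝ)⁻¹ * ∑ i ∈ s, (inner ℝ (x i) G) ^ 2) := by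
          rw [← h4]; ring
      _ ≤ _ := mul_le_mul_of_nonneg_left h2 (by linarith [batchLoss_nonneg (x := x) (y := y) s β])
  -- Dividing by `‖G‖²` needs `G ≠ 0`; a zero gradient forces zero loss, by pairing it with `z - β`.
  rcases (sq_nonneg ‖G‖).eq_or_lt with h0 | h0
  · rw [← h0]
    have hg : G = 0 := by simpa using h0.symm
    by_contra! hneg
    have hlt : L < 0 := by
      by_contra! hL0
      have := batchLoss_nonneg (x := x) (y := y) s β
      nlinarith [mul_nonneg hL0 this]
    have hzero : inner ℝ (batchGrad x y s β) (z - β) = -(2 * batchLoss x y s β) :=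
      inner_batchGrad_sub s β hz
    rw [← hG, hg, inner_zero_left] at hzero
    have : batchLoss x y s β = 0 := by linarith
    rw [this] at hneg
    simp at hneg
  · nlinarith

theorem supNorm_batchGrad_le {b : ℕ} {L : ℝ} (hL : IsSmoothnessConstant x b L)
    {s : Finset (Fin n)} (hs : s.card = b) (β : Vec d) {z : Vec d}
    (hz : z ∈ interpolators x y) :
    supNorm (batchGrad x y s β) ≤ L * supNorm (β - z) := by
  rw [supNorm, batchGrad_eq_mulVec s β hz]
  exact (hL s hs _).2

end BatchLoss

end DLN

/-! ### Scalar estimates for the logarithm and the relative entropy -/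

namespace DLN

/-- The generalised relative entropy `p ln(p / a) - p + a` of two positive numbers. -/
noncomputable def relEnt (p a : ℝ) : ℝ := p * Real.log (p / a) - p + a

theorem neg_log_one_sub_le {t : ℝ} (ht : |t| ≤ 1 / 2) : -Real.log (1 - t) ≤ t + 2 * t ^ 2 := by
  obtain ⟨h1, h2⟩ := abs_le.1 ht
  have h0 : 0 < 1 - t := by linarith
  have h := Real.log_le_sub_one_of_pos (inv_pos.2 h0)
  rw [Real.log_inv] at h
  have h3 : (1 - t)⁻¹ ≤ 1 + t + 2 * t ^ 2 := by
    rw [inv_le_iff_one_le_mul₀ h0]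
    nlinarith [mul_nonneg (sq_nonneg t) (by linarith : (0 : ℝ) ≤ 1 - 2 * t)]
  linarith

theorem log_one_sub_sq_ge {t : ℝ} (ht : |t| ≤ 1 / 2) :
    -Real.log ((1 - t) ^ 2) ≤ 2 * t + 4 * t ^ 2 := by
  rw [Real.log_pow]
  push_cast
  linarith [neg_log_one_sub_le ht]

theorem log_one_sub_sq_le {t : ℝ} (ht : |t| ≤ 1 / 2) :
    Real.log ((1 - t) ^ 2) ≤ -2 * t := by
  obtain ⟨h1, h2⟩ := abs_le.1 ht
  rw [Real.log_pow]
  push_cast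
  linarith [Real.log_le_sub_one_of_pos (by linarith : 0 < 1 - t)]

/-- The linear term of `qPlus` cancels that of the logarithm, so square-summable gradients suffice
for the series. -/
theorem qPlus_mem_Icc {t : ℝ} (ht : |t| ≤ 1 / 2) : 0 ≤ qPlus t ∧ qPlus t ≤ 4 * t ^ 2 := by
  unfold qPlus
  constructor <;> linarith [log_one_sub_sq_ge ht, log_one_sub_sq_le ht]

theorem qMinus_eq (t : ℝ) : qMinus t = qPlus (-t) := by
  simp [qMinus, qPlus]

theorem qMinus_mem_Icc {t : ℝ} (ht : |t| ≤ 1 / 2) : 0 ≤ qMinus t ∧ qMinus t ≤ 4 * t ^ 2 := by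
  have := qPlus_mem_Icc (t := -t) (by rwa [abs_neg])
  rwa [qMinus_eq, ← neg_sq t]

theorem q_eq {t : ℝ} (ht : |t| ≤ 1 / 2) : q t = (qPlus t + qMinus t) / 2 := by
  obtain ⟨h1, h2⟩ := abs_le.1 ht
  have h3 : (1 - t) ^ 2 ≠ 0 := by
    have : 0 < 1 - t := by linarith
    positivity
  have h4 : (1 + t) ^ 2 ≠ 0 := by
    have : 0 < 1 + t := by linarith
    positivity
  rw [q, qPlus, qMinus, show (1 - t ^ 2) ^ 2 = (1 - t) ^ 2 * (1 + t) ^ 2 by ring,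
    Real.log_mul h3 h4]
  ring

theorem q_nonneg {z : ℝ} (hz : |z| ≤ √2) : 0 ≤ q z := by
  have h : z ^ 2 ≤ 2 := by
    have := sq_le_sq' (by linarith [abs_nonneg z, Real.sqrt_nonneg 2]) hz
    rwa [sq_abs, Real.sq_sqrt zero_le_two] at this
  have h1 : Real.log ((1 - z ^ 2) ^ 2) ≤ 0 :=
    Real.log_nonpos (sq_nonneg _) (by nlinarith [sq_nonneg z])
  unfold q
  linarith

/-- Apply `log x ≤ x - 1` at `x = √a / √p`: entropy dominates the squared Hellinger distance. -/
theorem sq_sqrt_sub_sqrt_le_relEnt {p a : ℝ} (hp : 0 < p) (ha : 0 < a) :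
    (√a - √p) ^ 2 ≤ relEnt p a := by
  have hp' := Real.sqrt_pos.2 hp
  have ha' := Real.sqrt_pos.2 ha
  have h := Real.log_le_sub_one_of_pos (div_pos ha' hp')
  have h1 : Real.log (p / a) = -2 * Real.log (√a / √p) := by
    rw [Real.log_div hp.ne' ha.ne', Real.log_div ha'.ne' hp'.ne', Real.log_sqrt ha.le,
      Real.log_sqrt hp.le]
    ring
  have h2 : p * (√a / √p) = √a * √p := by
    rw [mul_div_assoc', div_eq_iff hp'.ne', mul_assoc, Real.mul_self_sqrt hp.le, mul_comm]
  have h3 := mul_le_mul_of_nonneg_left h hp.le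
  rw [mul_sub, h2] at h3
  rw [relEnt, h1]
  nlinarith [Real.sq_sqrt hp.le, Real.sq_sqrt ha.le]

theorem relEnt_nonneg {p a : ℝ} (hp : 0 < p) (ha : 0 < a) : 0 ≤ relEnt p a :=
  (sq_nonneg _).trans (sq_sqrt_sub_sqrt_le_relEnt hp ha)

/-- Using `log x ≤ x - 1` at `x = a / (2p)` instead of `a / p` leaves half of the linear term `a`,
at the cost of `p log 2 ≤ p`. -/
theorem le_of_relEnt {p a : ℝ} (hp : 0 < p) (ha : 0 < a) : a ≤ 2 * relEnt p a + 2 * p := by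
  have h := Real.log_le_sub_one_of_pos (div_pos ha (mul_pos two_pos hp))
  have h1 : Real.log (p / a) = -Real.log (a / (2 * p)) - Real.log 2 := by
    rw [Real.log_div hp.ne' ha.ne', Real.log_div ha.ne' (by positivity),
      Real.log_mul two_ne_zero hp.ne']
    ring
  have h2 : p * (a / (2 * p)) = a / 2 := by field_simp
  have h3 := mul_le_mul_of_nonneg_left h hp.le
  have h4 := mul_le_mul_of_nonneg_left (Real.log_two_lt_d9.le.trans (by norm_num : _ ≤ (1 : ℝ)))
    hp.le
  rw [mul_sub, h2] at h3
  rw [relEnt, h1]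
  nlinarith

theorem mul_exp_le_of_relEnt_le {p a V : ℝ} (hp : 0 < p) (ha : 0 < a) (h : relEnt p a ≤ V) :
    p * Real.exp (-(V / p + 1)) ≤ a := by
  have h1 : Real.log (p / a) ≤ V / p + 1 := by
    rw [← sub_le_iff_le_add, le_div_iff₀ hp]
    unfold relEnt at h
    linarith
  rw [Real.log_le_iff_le_exp (div_pos hp ha), div_le_iff₀ ha] at h1
  rw [Real.exp_neg, ← div_eq_mul_inv, div_le_iff₀ (Real.exp_pos _)]
  linarith

theorem relEnt_mul_sq_le {p a t : ℝ} (hp : 0 < p) (ha : 0 < a) (ht : |t| ≤ 1 / 2) :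
    relEnt p (a * (1 - t) ^ 2) ≤ relEnt p a + 2 * t * (p - a) + t ^ 2 * (a + 4 * p) := by
  obtain ⟨h1, h2⟩ := abs_le.1 ht
  have h0 : 0 < 1 - t := by linarith
  have h := mul_le_mul_of_nonneg_left (log_one_sub_sq_ge ht) hp.le
  rw [relEnt, relEnt, ← div_div, Real.log_div (div_pos hp ha).ne' (by positivity)]
  nlinarith

theorem tendsto_of_relEnt_tendsto_zero {p : ℝ} (hp : 0 < p) {a : ℕ → ℝ} (ha : ∀ k, 0 < a k)
    (h : Tendsto (fun k => relEnt p (a k)) atTop (𝓝 0)) : Tendsto a atTop (𝓝 p) := by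
  have h1 : Tendsto (fun k => (√(a k) - √p) ^ 2) atTop (𝓝 0) :=
    squeeze_zero (fun _ => sq_nonneg _) (fun k => sq_sqrt_sub_sqrt_le_relEnt hp (ha k)) h
  have h2 : Tendsto (fun k => √(a k) - √p) atTop (𝓝 0) := by
    rw [tendsto_zero_iff_abs_tendsto_zero]
    simpa [Function.comp_def, Real.sqrt_sq_eq_abs] using h1.sqrt
  have h3 : Tendsto (fun k => √(a k)) atTop (𝓝 (√p)) := by
    simpa using h2.add_const (√p)
  simpa [Real.sq_sqrt hp.le, fun k => Real.sq_sqrt (ha k).le] using h3.pow 2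

end DLN

/-! ### Hyperbolic entropy and Bregman projections -/

namespace DLN

theorem hasDerivAt_hypEntropy_coord {A : ℝ} (hA : 0 < A) (t : ℝ) :
    HasDerivAt (fun t => t * Real.arsinh (t / A) - √(t ^ 2 + A ^ 2) + A)
      (Real.arsinh (t / A)) t := by
  have h1 : HasDerivAt (fun t => Real.arsinh (t / A)) ((√(1 + (t / A) ^ 2))⁻¹ * (1 / A)) t := by
    simpa using ((hasDerivAt_id t).div_const A).arsinh
  have hpos : 0 < t ^ 2 + A ^ 2 := by positivity
  have h2 : HasDerivAt (fun t => √(t ^ 2 + A ^ 2)) (2 * t / (2 * √(t ^ 2 + A ^ 2))) t := by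
    have : HasDerivAt (fun t : ℝ => t ^ 2 + A ^ 2) (2 * t) t := by
      simpa using (hasDerivAt_pow 2 t).add_const (A ^ 2)
    exact this.sqrt hpos.ne'
  have h3 : √(1 + (t / A) ^ 2) = √(t ^ 2 + A ^ 2) / A := by
    rw [show 1 + (t / A) ^ 2 = (t ^ 2 + A ^ 2) / A ^ 2 by field_simp; ring,
      Real.sqrt_div hpos.le, Real.sqrt_sq hA.le]
  refine ((((hasDerivAt_id t).mul h1).sub h2).add_const A).congr_deriv ?_
  have := Real.sqrt_pos.2 hpos
  rw [h3]
  simp only [id]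
  field_simp
  ring

theorem lt_hypEntropy_coord {A : ℝ} (hA : 0 < A) {s t : ℝ} (hst : s ≠ t) :
    (s * Real.arsinh (s / A) - √(s ^ 2 + A ^ 2) + A) + Real.arsinh (s / A) * (t - s)
      < t * Real.arsinh (t / A) - √(t ^ 2 + A ^ 2) + A := by
  set f : ℝ → ℝ := fun t => t * Real.arsinh (t / A) - √(t ^ 2 + A ^ 2) + A with hf
  have hd : ∀ t, HasDerivAt f (Real.arsinh (t / A)) t := hasDerivAt_hypEntropy_coord hA
  have hcvx : StrictConvexOn ℝ Set.univ f := by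
    refine StrictMono.strictConvexOn_univ_of_deriv
      (continuous_iff_continuousAt.2 fun t => (hd t).continuousAt) fun a b hab => ?_
    rw [(hd a).deriv, (hd b).deriv]
    exact Real.arsinh_strictMono (div_lt_div_of_pos_right hab hA)
  rcases hst.lt_or_gt with h | h
  · have := hcvx.lt_slope_of_hasDerivAt (Set.mem_univ _) (Set.mem_univ _) h (hd s)
    rw [slope_def_field, lt_div_iff₀ (sub_pos.2 h)] at this
    change f s + _ < f t
    linarith
  · have := hcvx.slope_lt_of_hasDerivAt (Set.mem_univ _) (Set.mem_univ _) h (hd s)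
    rw [slope_def_field, div_lt_iff₀ (sub_pos.2 h)] at this
    change f s + _ < f t
    linarith

variable {d : ℕ} {α : Vec d}

theorem hypEntropy_eq (α β : Vec d) : hypEntropy α β = 1 / 2 *
    ∑ i, (β i * Real.arsinh (β i / α i ^ 2) - √(β i ^ 2 + (α i ^ 2) ^ 2) + α i ^ 2) := by
  simp only [hypEntropy, ← pow_mul]

theorem hasGradientAt_hypEntropy (hα : ∀ i, 0 < α i) (β : Vec d) :
    HasGradientAt (hypEntropy α)
      (WithLp.toLp 2 fun i => 1 / 2 * Real.arsinh (β i / α i ^ 2)) β := by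
  rw [hasGradientAt_iff_hasFDerivAt]
  have h : ∀ i ∈ Finset.univ, HasFDerivAt (fun β : Vec d =>
      β i * Real.arsinh (β i / α i ^ 2) - √(β i ^ 2 + (α i ^ 2) ^ 2) + α i ^ 2)
      (Real.arsinh (β i / α i ^ 2) • (EuclideanSpace.proj i : Vec d →L[ℝ] ℝ)) β := fun i _ =>
    HasDerivAt.comp_hasFDerivAt (f := fun β : Vec d => β i) β
      (hasDerivAt_hypEntropy_coord (pow_pos (hα i) 2) (β i))
      (EuclideanSpace.proj i : Vec d →L[ℝ] ℝ).hasFDerivAt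
  have h2 := (HasFDerivAt.fun_sum h).const_mul (1 / 2)
  rw [show hypEntropy α = _ from funext (hypEntropy_eq α)]
  refine h2.congr_fderiv ?_
  ext z
  simp only [smul_apply, sum_apply, PiLp.proj_apply, smul_eq_mul,
    InnerProductSpace.toDual_apply_apply, PiLp.inner_apply, Finset.mul_sum]
  refine Finset.sum_congr rfl fun i _ => ?_
  simp
  ring

theorem inner_gradient_hypEntropy (hα : ∀ i, 0 < α i) (β z : Vec d) :
    inner ℝ (gradient (hypEntropy α) β) z
      = ∑ i, 1 / 2 * Real.arsinh (β i / α i ^ 2) * z i := by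
  rw [(hasGradientAt_hypEntropy hα β).gradient, PiLp.inner_apply]
  refine Finset.sum_congr rfl fun i _ => ?_
  simp
  ring

theorem bregman_hypEntropy_pos (hα : ∀ i, 0 < α i) {β β' : Vec d} (h : β ≠ β') :
    0 < bregman (hypEntropy α) β β' := by
  have hterm : ∀ i, (β' i * Real.arsinh (β' i / α i ^ 2) - √(β' i ^ 2 + (α i ^ 2) ^ 2) + α i ^ 2)
      + Real.arsinh (β' i / α i ^ 2) * (β i - β' i)
      ≤ β i * Real.arsinh (β i / α i ^ 2) - √(β i ^ 2 + (α i ^ 2) ^ 2) + α i ^ 2 := by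
    intro i
    rcases eq_or_ne (β' i) (β i) with hi | hi
    · rw [hi]; simp
    · exact (lt_hypEntropy_coord (pow_pos (hα i) 2) hi).le
  obtain ⟨i, hi⟩ : ∃ i, β' i ≠ β i := by
    by_contra! hne
    exact h (PiLp.ext fun i => (hne i).symm)
  have hlt := Finset.sum_lt_sum (fun i _ => hterm i)
    ⟨i, Finset.mem_univ i, lt_hypEntropy_coord (pow_pos (hα i) 2) hi⟩
  have hgrad : ∑ i, Real.arsinh (β' i / α i ^ 2) * (β i - β' i)
      = 2 * inner ℝ (gradient (hypEntropy α) β') (β - β') := by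
    rw [inner_gradient_hypEntropy hα, Finset.mul_sum]
    refine Finset.sum_congr rfl fun i _ => ?_
    rw [PiLp.sub_apply]
    ring
  rw [Finset.sum_add_distrib, hgrad] at hlt
  rw [bregman, hypEntropy_eq, hypEntropy_eq]
  linarith

/-- The optimality conditions characterise the Bregman projection onto an affine set. -/
theorem argminOn_bregman_hypEntropy (hα : ∀ i, 0 < α i) {S : Set (Vec d)} {β β₀ : Vec d}
    (hβ : β ∈ S)
    (h : ∀ z ∈ S, inner ℝ (gradient (hypEntropy α) β - gradient (hypEntropy α) β₀) (z - β) = 0) :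
    argminOn (fun z => bregman (hypEntropy α) z β₀) S = {β} := by
  -- The three-point identity; its cross term vanishes by `h`, leaving a Pythagorean equality.
  have key : ∀ z ∈ S, bregman (hypEntropy α) z β₀
      = bregman (hypEntropy α) β β₀ + bregman (hypEntropy α) z β := by
    intro z hz
    have h1 := h z hz
    rw [inner_sub_left] at h1
    have h2 : inner ℝ (gradient (hypEntropy α) β₀) (z - β₀)
        = inner ℝ (gradient (hypEntropy α) β₀) (z - β)
          + inner ℝ (gradient (hypEntropy α) β₀) (β - β₀) := by
      rw [← inner_add_right, sub_add_sub_cancel]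
    simp only [bregman]
    linarith
  ext z
  constructor
  · rintro ⟨hz, hmin⟩
    by_contra hne
    have h1 := bregman_hypEntropy_pos hα hne
    have h2 : bregman (hypEntropy α) z β₀ ≤ bregman (hypEntropy α) β β₀ := hmin hβ
    linarith [key z hz]
  · rintro rfl
    refine ⟨hβ, fun w hw => ?_⟩
    change bregman (hypEntropy α) z β₀ ≤ bregman (hypEntropy α) w β₀
    rcases eq_or_ne w z with rfl | hne
    · rfl
    · linarith [key w hw, bregman_hypEntropy_pos hα hne]

end DLN

/-! ### Entropy descent and uniform control of the iterates -/

namespace DLN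

/-- The sum of the coordinatewise relative entropies of `(a, b)` with respect to `(p, r)`. -/
noncomputable def lyapunov {d : ℕ} (p r a b : Fin d → ℝ) : ℝ :=
  ∑ i, (relEnt (p i) (a i) + relEnt (r i) (b i))

theorem lyapunov_nonneg {d : ℕ} {p r a b : Fin d → ℝ} (hp : ∀ i, 0 < p i) (hr : ∀ i, 0 < r i)
    (ha : ∀ i, 0 < a i) (hb : ∀ i, 0 < b i) : 0 ≤ lyapunov p r a b :=
  Finset.sum_nonneg fun i _ => add_nonneg (relEnt_nonneg (hp i) (ha i))
    (relEnt_nonneg (hr i) (hb i))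

theorem relEnt_add_le_lyapunov {d : ℕ} {p r a b : Fin d → ℝ} (hp : ∀ i, 0 < p i)
    (hr : ∀ i, 0 < r i) (ha : ∀ i, 0 < a i) (hb : ∀ i, 0 < b i) (i : Fin d) :
    relEnt (p i) (a i) + relEnt (r i) (b i) ≤ lyapunov p r a b :=
  Finset.single_le_sum (f := fun i => relEnt (p i) (a i) + relEnt (r i) (b i))
    (fun i _ => add_nonneg (relEnt_nonneg (hp i) (ha i)) (relEnt_nonneg (hr i) (hb i)))
    (Finset.mem_univ i)

section Deterministic

variable {n d : ℕ} {x : Fin n → Vec d} {y : Fin n → ℝ} {α : Vec d} {γ : ℕ → ℝ}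
  {s : ℕ → Finset (Fin n)} {b : ℕ} {L : ℝ}

theorem sum_sq_scaledGrad_le (hL : IsSmoothnessConstant x b L) (hs : ∀ k, (s k).card = b)
    (hne : (interpolators x y).Nonempty) (k : ℕ) :
    ∑ i, scaledGrad x y α γ s k i ^ 2
      ≤ γ k ^ 2 * (2 * L * batchLoss x y (s k) (predictor x y α γ s k)) := by
  obtain ⟨z, hz⟩ := hne
  have h := norm_batchGrad_sq_le hL (hs k) (predictor x y α γ s k) hz
  rw [EuclideanSpace.real_norm_sq_eq] at h
  have h2 := mul_le_mul_of_nonneg_left h (sq_nonneg (γ k))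
  rw [Finset.mul_sum] at h2
  simpa [scaledGrad_eq, mul_pow] using h2

/-- The first-order change is `4 ⟨g, z - β⟩ = -8 γ ℓ`; the second-order one is at most `10 R ‖g‖² ≤
20 (γ L R) γ ℓ ≤ 2 γ ℓ`. -/
theorem lyapunov_succ_le (hL : IsSmoothnessConstant x b L) (hs : ∀ k, (s k).card = b)
    {p r : Fin d → ℝ} (hp : ∀ i, 0 < p i) (hr : ∀ i, 0 < r i)
    (hz : (WithLp.toLp 2 fun i => (p i - r i) / 2 : Vec d) ∈ interpolators x y)
    {R : ℝ} {k : ℕ} (hγ : 0 ≤ γ k) (hγR : γ k * L * R ≤ 1 / 10)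
    (hpR : ∀ i, p i ≤ R) (hrR : ∀ i, r i ≤ R)
    (ha : ∀ i, 0 < plusSq x y α γ s k i) (hb : ∀ i, 0 < minusSq x y α γ s k i)
    (haR : ∀ i, plusSq x y α γ s k i ≤ R) (hbR : ∀ i, minusSq x y α γ s k i ≤ R)
    (hg : ∀ i, |scaledGrad x y α γ s k i| ≤ 1 / 2) :
    lyapunov p r (plusSq x y α γ s (k + 1)) (minusSq x y α γ s (k + 1))
        + 4 * (γ k * batchLoss x y (s k) (predictor x y α γ s k))
      ≤ lyapunov p r (plusSq x y α γ s k) (minusSq x y α γ s k) := by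
  set z : Vec d := WithLp.toLp 2 fun i => (p i - r i) / 2 with hzdef
  set g := scaledGrad x y α γ s k with hgdef
  set β := predictor x y α γ s k with hβ
  set ℓ := batchLoss x y (s k) β with hℓ
  have hℓ0 : 0 ≤ ℓ := batchLoss_nonneg _ _
  have hterm : ∀ i, relEnt (p i) (plusSq x y α γ s (k + 1) i)
        + relEnt (r i) (minusSq x y α γ s (k + 1) i)
      ≤ (relEnt (p i) (plusSq x y α γ s k i) + relEnt (r i) (minusSq x y α γ s k i))
        + (4 * (g i * (z i - β i)) + 10 * R * g i ^ 2) := by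
    intro i
    have h1 := relEnt_mul_sq_le (hp i) (ha i) (hg i)
    have h2 := relEnt_mul_sq_le (hr i) (hb i) (t := -g i) (by rw [abs_neg]; exact hg i)
    have h3 : z i - β i = (p i - r i) / 2
        - (plusSq x y α γ s k i - minusSq x y α γ s k i) / 2 := by
      rw [hβ, predictor_apply]
    rw [sub_neg_eq_add] at h2
    rw [plusSq_succ, minusSq_succ, h3]
    have h4 : g i ^ 2 * (plusSq x y α γ s k i + 4 * p i)
        + g i ^ 2 * (minusSq x y α γ s k i + 4 * r i) ≤ 10 * R * g i ^ 2 := by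
      nlinarith [mul_le_mul_of_nonneg_left (haR i) (sq_nonneg (g i)),
        mul_le_mul_of_nonneg_left (hbR i) (sq_nonneg (g i)),
        mul_le_mul_of_nonneg_left (hpR i) (sq_nonneg (g i)),
        mul_le_mul_of_nonneg_left (hrR i) (sq_nonneg (g i))]
    rw [neg_sq] at h2
    linarith
  have hsum : lyapunov p r (plusSq x y α γ s (k + 1)) (minusSq x y α γ s (k + 1))
      ≤ lyapunov p r (plusSq x y α γ s k) (minusSq x y α γ s k)
        + (4 * ∑ i, g i * (z i - β i) + 10 * R * ∑ i, g i ^ 2) := by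
    simp only [lyapunov, Finset.mul_sum, ← Finset.sum_add_distrib]
    exact Finset.sum_le_sum fun i _ => hterm i
  have hinner : ∑ i, g i * (z i - β i) = -(2 * (γ k * ℓ)) := by
    have h := inner_batchGrad_sub (s k) β hz
    rw [PiLp.inner_apply] at h
    have h' := congrArg (γ k * ·) h
    simp only [Finset.mul_sum] at h'
    rw [hgdef, scaledGrad_eq]
    convert h' using 1
    · refine Finset.sum_congr rfl fun i _ => ?_
      simp [← hβ]
      ring
    · ring
  have hsq : R * ∑ i, g i ^ 2 ≤ 1 / 5 * (γ k * ℓ) := by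
    -- For `d = 0` the hypotheses do not determine the sign of `R`.
    rcases isEmpty_or_nonempty (Fin d) with hd | ⟨⟨i⟩⟩
    · simpa using mul_nonneg hγ hℓ0
    · have hR : 0 ≤ R := (hp i).le.trans (hpR i)
      have h := mul_le_mul_of_nonneg_left
        (sum_sq_scaledGrad_le (α := α) (γ := γ) hL hs ⟨z, hz⟩ k) hR
      have h2 := mul_le_mul_of_nonneg_right hγR (mul_nonneg hγ hℓ0)
      calc R * ∑ i, g i ^ 2 ≤ R * (γ k ^ 2 * (2 * L * ℓ)) := h
        _ = 2 * (γ k * L * R * (γ k * ℓ)) := by ring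
        _ ≤ 1 / 5 * (γ k * ℓ) := by linarith
  have hnn := mul_nonneg hγ hℓ0
  linarith

/-- The quantitative control of the iterates on which the convergence analysis rests. -/
structure IsControlled {n d : ℕ} (x : Fin n → Vec d) (y : Fin n → ℝ) (α : Vec d) (γ : ℕ → ℝ)
    (s : ℕ → Finset (Fin n)) (lo lo' : Fin d → ℝ) (R E : ℝ) : Prop where
  lo_pos : ∀ i, 0 < lo i
  lo'_pos : ∀ i, 0 < lo' i
  plus_mem : ∀ k i, lo i ≤ plusSq x y α γ s k i ∧ plusSq x y α γ s k i ≤ R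
  minus_mem : ∀ k i, lo' i ≤ minusSq x y α γ s k i ∧ minusSq x y α γ s k i ≤ R
  supNorm_scaledGrad : ∀ k, supNorm (scaledGrad x y α γ s k) ≤ 1 / 2
  energy : ∀ N, ∑ k ∈ Finset.range N, γ k * batchLoss x y (s k) (predictor x y α γ s k) ≤ E

theorem abs_le_supNorm (v : Vec d) (i : Fin d) : |v i| ≤ supNorm v :=
  norm_le_pi_norm (WithLp.ofLp v) i

theorem supNorm_le {v : Vec d} {C : ℝ} (hC : 0 ≤ C) (h : ∀ i, |v i| ≤ C) : supNorm v ≤ C :=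
  (pi_norm_le_iff_of_nonneg hC).2 h

/-- The bounds come from the initial entropy relative to one fixed interpolator, so they are chosen
before `b`, `L`, `γ` and the batches. Descent needs the bounds and the bounds need descent;
induction on the step resolves this. -/
theorem exists_isControlled (hα : ∀ i, 0 < α i) (hne : (interpolators x y).Nonempty) :
    ∃ lo lo' : Fin d → ℝ, ∃ R E : ℝ, 0 < R ∧
      ∀ (b : ℕ) (L : ℝ), 0 < L → IsSmoothnessConstant x b L →
      ∀ γ : ℕ → ℝ, (∀ k, 0 ≤ γ k) → (∀ k, γ k * L * R ≤ 1 / 10) →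
      ∀ s : ℕ → Finset (Fin n), (∀ k, (s k).card = b) → IsControlled x y α γ s lo lo' R E := by
  obtain ⟨z, hz⟩ := hne
  -- A splitting `z = (p - r) / 2` with both parts at least `1`.
  let p : Fin d → ℝ := fun i => |z i| + z i + 1
  let r : Fin d → ℝ := fun i => |z i| - z i + 1
  have hp : ∀ i, 0 < p i := fun i => by
    change 0 < |z i| + z i + 1
    linarith [neg_abs_le (z i)]
  have hr : ∀ i, 0 < r i := fun i => by
    change 0 < |z i| - z i + 1
    linarith [le_abs_self (z i)]
  have hzpr : (WithLp.toLp 2 fun i => (p i - r i) / 2 : Vec d) = z :=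
    PiLp.ext fun i => by simp only [p, r]; ring
  have hα2 : ∀ i, 0 < α i ^ 2 := fun i => pow_pos (hα i) 2
  let V : ℝ := lyapunov p r (fun i => α i ^ 2) (fun i => α i ^ 2)
  have hV : 0 ≤ V := lyapunov_nonneg hp hr hα2 hα2
  let K : ℝ := 1 + 2 * supNorm z
  have hz0 : 0 ≤ supNorm z := norm_nonneg _
  have hpK : ∀ i, p i ≤ K := fun i => by
    change |z i| + z i + 1 ≤ 1 + 2 * supNorm z
    linarith [le_abs_self (z i), abs_le_supNorm z i]
  have hrK : ∀ i, r i ≤ K := fun i => by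
    change |z i| - z i + 1 ≤ 1 + 2 * supNorm z
    linarith [neg_abs_le (z i), abs_le_supNorm z i]
  have hR : 2 * V + 2 * K = 2 * V + 2 + 4 * supNorm z := by ring
  refine ⟨fun i => p i * Real.exp (-(V / p i + 1)), fun i => r i * Real.exp (-(V / r i + 1)),
    2 * V + 2 * K, V, by linarith, fun b L hL0 hL γ hγ hγR s hs => ?_⟩
  have hbound : ∀ {a c : Fin d → ℝ}, (∀ i, 0 < a i) → (∀ i, 0 < c i) → lyapunov p r a c ≤ V →
      ∀ i, (p i * Real.exp (-(V / p i + 1)) ≤ a i ∧ a i ≤ 2 * V + 2 * K) ∧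
        (r i * Real.exp (-(V / r i + 1)) ≤ c i ∧ c i ≤ 2 * V + 2 * K) := by
    intro a c ha hc h i
    have h1 := (relEnt_add_le_lyapunov hp hr ha hc i).trans h
    have h2 := relEnt_nonneg (hp i) (ha i)
    have h3 := relEnt_nonneg (hr i) (hc i)
    refine ⟨⟨mul_exp_le_of_relEnt_le (hp i) (ha i) (by linarith), ?_⟩,
      ⟨mul_exp_le_of_relEnt_le (hr i) (hc i) (by linarith), ?_⟩⟩
    · linarith [le_of_relEnt (hp i) (ha i), hpK i]
    · linarith [le_of_relEnt (hr i) (hc i), hrK i]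
  have hgrad : ∀ k, (∀ i, 0 < plusSq x y α γ s k i) → (∀ i, 0 < minusSq x y α γ s k i) →
      lyapunov p r (plusSq x y α γ s k) (minusSq x y α γ s k) ≤ V →
      supNorm (scaledGrad x y α γ s k) ≤ 1 / 2 := by
    intro k ha hc h
    have h1 : supNorm (predictor x y α γ s k - z) ≤ 2 * V + 2 * K := by
      refine supNorm_le (by linarith) fun i => ?_
      have h2 := hbound ha hc h i
      have h3 := ha i
      have h4 := hc i
      have h5 := abs_le.1 (abs_le_supNorm z i)
      rw [PiLp.sub_apply, predictor_apply, abs_le]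
      constructor <;> linarith [h2.1.2, h2.2.2]
    have h2 : supNorm (scaledGrad x y α γ s k)
        = γ k * supNorm (batchGrad x y (s k) (predictor x y α γ s k)) := by
      rw [scaledGrad_eq, supNorm, WithLp.ofLp_smul, norm_smul, Real.norm_of_nonneg (hγ k), supNorm]
    have h3 := (supNorm_batchGrad_le hL (hs k) (predictor x y α γ s k) hz).trans
      (mul_le_mul_of_nonneg_left h1 hL0.le)
    rw [h2]
    nlinarith [mul_le_mul_of_nonneg_left h3 (hγ k), hγR k]
  -- The spent energy is carried along, so the same induction also bounds `∑ γ ℓ`.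
  have key : ∀ k, (∀ i, 0 < plusSq x y α γ s k i) ∧ (∀ i, 0 < minusSq x y α γ s k i) ∧
      lyapunov p r (plusSq x y α γ s k) (minusSq x y α γ s k) +
        4 * ∑ j ∈ Finset.range k, γ j * batchLoss x y (s j) (predictor x y α γ s j) ≤ V := by
    intro k
    induction k with
    | zero =>
      refine ⟨fun i => by rw [plusSq_zero]; exact hα2 i,
        fun i => by rw [minusSq_zero]; exact hα2 i, ?_⟩
      simp only [Finset.range_zero, Finset.sum_empty, mul_zero, add_zero]
      rw [show plusSq x y α γ s 0 = fun i => α i ^ 2 from funext (plusSq_zero x y α γ s),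
        show minusSq x y α γ s 0 = fun i => α i ^ 2 from funext (minusSq_zero x y α γ s)]
    | succ k ih =>
      obtain ⟨ha, hc, h⟩ := ih
      have hE : 0 ≤ ∑ j ∈ Finset.range k,
          γ j * batchLoss x y (s j) (predictor x y α γ s j) :=
        Finset.sum_nonneg fun j _ => mul_nonneg (hγ j) (batchLoss_nonneg _ _)
      have hle : lyapunov p r (plusSq x y α γ s k) (minusSq x y α γ s k) ≤ V := by linarith
      have hg : ∀ i, |scaledGrad x y α γ s k i| ≤ 1 / 2 := fun i =>
        (abs_le_supNorm _ i).trans (hgrad k ha hc hle)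
      refine ⟨fun i => ?_, fun i => ?_, ?_⟩
      · have : 0 < 1 - scaledGrad x y α γ s k i := by linarith [(abs_le.1 (hg i)).2]
        rw [plusSq_succ]
        exact mul_pos (ha i) (pow_pos this 2)
      · have : 0 < 1 + scaledGrad x y α γ s k i := by linarith [(abs_le.1 (hg i)).1]
        rw [minusSq_succ]
        exact mul_pos (hc i) (pow_pos this 2)
      · have hstep := lyapunov_succ_le hL hs hp hr (by rw [hzpr]; exact hz) (hγ k) (hγR k)
          (fun i => (hpK i).trans (by linarith)) (fun i => (hrK i).trans (by linarith)) ha hc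
          (fun i => (hbound ha hc hle i).1.2) (fun i => (hbound ha hc hle i).2.2) hg
        rw [Finset.sum_range_succ]
        linarith
  have hle : ∀ k, lyapunov p r (plusSq x y α γ s k) (minusSq x y α γ s k) ≤ V := by
    intro k
    have hE : 0 ≤ ∑ j ∈ Finset.range k,
        γ j * batchLoss x y (s j) (predictor x y α γ s j) :=
      Finset.sum_nonneg fun j _ => mul_nonneg (hγ j) (batchLoss_nonneg _ _)
    linarith [(key k).2.2]
  exact
    { lo_pos := fun i => mul_pos (hp i) (Real.exp_pos _)
      lo'_pos := fun i => mul_pos (hr i) (Real.exp_pos _)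
      plus_mem := fun k i => (hbound (key k).1 (key k).2.1 (hle k) i).1
      minus_mem := fun k i => (hbound (key k).1 (key k).2.1 (hle k) i).2
      supNorm_scaledGrad := fun k => hgrad k (key k).1 (key k).2.1 (hle k)
      energy := fun N => by
        have h1 := lyapunov_nonneg hp hr (key N).1 (key N).2.1
        have hE : 0 ≤ ∑ j ∈ Finset.range N,
            γ j * batchLoss x y (s j) (predictor x y α γ s j) :=
          Finset.sum_nonneg fun j _ => mul_nonneg (hγ j) (batchLoss_nonneg _ _)
        linarith [(key N).2.2] }

namespace IsControlled

variable {lo lo' : Fin d → ℝ} {R E : ℝ}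

theorem plus_pos (hC : IsControlled x y α γ s lo lo' R E)
    (k : ℕ) (i : Fin d) : 0 < plusSq x y α γ s k i :=
  (hC.lo_pos i).trans_le (hC.plus_mem k i).1

theorem minus_pos (hC : IsControlled x y α γ s lo lo' R E)
    (k : ℕ) (i : Fin d) : 0 < minusSq x y α γ s k i :=
  (hC.lo'_pos i).trans_le (hC.minus_mem k i).1

theorem abs_scaledGrad_le (hC : IsControlled x y α γ s lo lo' R E)
    (k : ℕ) (i : Fin d) : |scaledGrad x y α γ s k i| ≤ 1 / 2 :=
  (abs_le_supNorm _ i).trans (hC.supNorm_scaledGrad k)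

theorem supNorm_predictor_le (hC : IsControlled x y α γ s lo lo' R E)
    (hR : 0 ≤ R) (k : ℕ) : supNorm (predictor x y α γ s k) ≤ R := by
  refine supNorm_le hR fun i => ?_
  rw [predictor_apply, abs_le]
  constructor <;>
    linarith [(hC.plus_mem k i).2, (hC.minus_mem k i).2, hC.plus_pos k i, hC.minus_pos k i]

theorem summable_energy (hC : IsControlled x y α γ s lo lo' R E)
    (hγ : ∀ k, 0 ≤ γ k) :
    Summable fun k => γ k * batchLoss x y (s k) (predictor x y α γ s k) :=
  summable_of_sum_range_le (fun k => mul_nonneg (hγ k) (batchLoss_nonneg _ _)) hC.energy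

theorem summable_sq (hC : IsControlled x y α γ s lo lo' R E)
    (hL : IsSmoothnessConstant x b L) (hs : ∀ k, (s k).card = b)
    (hne : (interpolators x y).Nonempty) (hR : 0 < R) (hγ : ∀ k, 0 ≤ γ k)
    (hγR : ∀ k, γ k * L * R ≤ 1 / 10) (i : Fin d) :
    Summable fun k => scaledGrad x y α γ s k i ^ 2 := by
  refine Summable.of_nonneg_of_le (fun _ => sq_nonneg _) (fun k => ?_)
    ((hC.summable_energy hγ).mul_left (1 / (5 * R)))
  have h1 : scaledGrad x y α γ s k i ^ 2 ≤ ∑ i, scaledGrad x y α γ s k i ^ 2 :=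
    Finset.single_le_sum (f := fun i => scaledGrad x y α γ s k i ^ 2)
      (fun _ _ => sq_nonneg _) (Finset.mem_univ i)
  refine (h1.trans (sum_sq_scaledGrad_le hL hs hne k)).trans ?_
  have h2 := mul_le_mul_of_nonneg_right (hγR k)
    (mul_nonneg (hγ k) (batchLoss_nonneg (x := x) (y := y) (s k) (predictor x y α γ s k)))
  rw [one_div, ← div_eq_inv_mul, le_div_iff₀ (by positivity)]
  nlinarith

theorem summable_qPlus (hC : IsControlled x y α γ s lo lo' R E)
    (h : ∀ i, Summable fun k => scaledGrad x y α γ s k i ^ 2) (i : Fin d) :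
    Summable fun k => qPlus (scaledGrad x y α γ s k i) :=
  Summable.of_nonneg_of_le (fun k => (qPlus_mem_Icc (hC.abs_scaledGrad_le k i)).1)
    (fun k => (qPlus_mem_Icc (hC.abs_scaledGrad_le k i)).2) ((h i).mul_left 4)

theorem summable_qMinus (hC : IsControlled x y α γ s lo lo' R E)
    (h : ∀ i, Summable fun k => scaledGrad x y α γ s k i ^ 2) (i : Fin d) :
    Summable fun k => qMinus (scaledGrad x y α γ s k i) :=
  Summable.of_nonneg_of_le (fun k => (qMinus_mem_Icc (hC.abs_scaledGrad_le k i)).1)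
    (fun k => (qMinus_mem_Icc (hC.abs_scaledGrad_le k i)).2) ((h i).mul_left 4)

end IsControlled

end Deterministic

end DLN

/-! ### Convergence and implicit bias -/

namespace DLN

section Convergence

variable {n d : ℕ} {x : Fin n → Vec d} {y : Fin n → ℝ} {α : Vec d} {γ : ℕ → ℝ}
  {s : ℕ → Finset (Fin n)} {b : ℕ} {L : ℝ} {lo lo' : Fin d → ℝ} {R E : ℝ}

/-- The total loss over all batches of size `b`. -/
noncomputable def totalLoss {n d : ℕ} (x : Fin n → Vec d) (y : Fin n → ℝ) (b : ℕ) (β : Vec d) :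
    ℝ :=
  ∑ t ∈ Finset.powersetCard b Finset.univ, batchLoss x y t β

theorem totalLoss_nonneg (b : ℕ) (β : Vec d) : 0 ≤ totalLoss x y b β :=
  Finset.sum_nonneg fun t _ => batchLoss_nonneg t β

theorem continuous_totalLoss (b : ℕ) : Continuous (totalLoss x y b) :=
  continuous_finsetSum _ fun t _ => continuous_batchLoss t

theorem mem_interpolators_of_totalLoss_eq_zero (hb : 1 ≤ b) (hbn : b ≤ n) {β : Vec d}
    (h : totalLoss x y b β = 0) : β ∈ interpolators x y := by
  intro i
  obtain ⟨t, hit, -, ht⟩ := Finset.exists_subsuperset_card_eq (Finset.subset_univ {i})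
    (n := b) (by simpa using hb) (by simpa using hbn)
  rw [totalLoss, Finset.sum_eq_zero_iff_of_nonneg fun t _ => batchLoss_nonneg t β] at h
  exact inner_eq_of_batchLoss_eq_zero (h t (Finset.mem_powersetCard_univ.2 ht))
    (Finset.singleton_subset_iff.1 hit)

/-- If eventually `f ≥ ε`, then `γ ≤ ε⁻¹ γ f` would make `γ` summable. -/
theorem frequently_lt_of_summable_mul {γ f : ℕ → ℝ} (hγ : ∀ k, 0 ≤ γ k) (hns : ¬ Summable γ)
    (h : Summable fun k => γ k * f k) {ε : ℝ} (hε : 0 < ε) : ∃ᶠ k in atTop, f k < ε := by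
  intro hev
  refine hns ?_
  refine (h.mul_left ε⁻¹).of_norm_bounded_eventually_nat ?_
  filter_upwards [hev] with k hk
  rw [Real.norm_of_nonneg (hγ k), ← div_eq_inv_mul, le_div_iff₀ hε]
  exact mul_le_mul_of_nonneg_left (not_lt.1 hk) (hγ k)

theorem tendsto_predictor {p r : Fin d → ℝ}
    {φ : ℕ → ℕ} (ha : ∀ i, Tendsto (fun k => plusSq x y α γ s (φ k) i) atTop (𝓝 (p i)))
    (hb : ∀ i, Tendsto (fun k => minusSq x y α γ s (φ k) i) atTop (𝓝 (r i))) :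
    Tendsto (fun k => predictor x y α γ s (φ k)) atTop
      (𝓝 (WithLp.toLp 2 fun i => (p i - r i) / 2)) := by
  have h : Tendsto (fun k i => predictor x y α γ s (φ k) i) atTop
      (𝓝 fun i => (p i - r i) / 2) := by
    refine tendsto_pi_nhds.2 fun i => ?_
    simp only [predictor_apply]
    exact ((ha i).sub (hb i)).div_const 2
  exact ((PiLp.continuous_toLp 2 fun _ : Fin d => ℝ).tendsto _).comp h

namespace IsControlled

theorem tendsto (hC : IsControlled x y α γ s lo lo' R E) (hL : IsSmoothnessConstant x b L)
    (hs : ∀ k, (s k).card = b) (hγ : ∀ k, 0 ≤ γ k) (hγR : ∀ k, γ k * L * R ≤ 1 / 10)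
    (hb : 1 ≤ b) (hbn : b ≤ n) (hns : ¬ Summable γ)
    (htot : Summable fun k => γ k * totalLoss x y b (predictor x y α γ s k)) :
    ∃ p r : Fin d → ℝ, (∀ i, 0 < p i) ∧ (∀ i, 0 < r i) ∧
      (WithLp.toLp 2 fun i => (p i - r i) / 2 : Vec d) ∈ interpolators x y ∧
      (∀ i, Tendsto (fun k => plusSq x y α γ s k i) atTop (𝓝 (p i))) ∧
      (∀ i, Tendsto (fun k => minusSq x y α γ s k i) atTop (𝓝 (r i))) := by
  obtain ⟨φ, hφ, hφlt⟩ := extraction_forall_of_frequently fun m : ℕ =>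
    frequently_lt_of_summable_mul hγ hns htot (Nat.one_div_pos_of_nat (α := ℝ) (n := m))
  -- The lower corner is positive, so cluster points are admissible reference points for the
  -- entropy.
  have hcpt : IsCompact (Set.Icc (lo, lo')
      ((fun _ => R, fun _ => R) : (Fin d → ℝ) × (Fin d → ℝ))) :=
    isCompact_Icc
  obtain ⟨⟨p, r⟩, hmem, ψ, hψ, hlim⟩ := hcpt.tendsto_subseq
    (x := fun m => (plusSq x y α γ s (φ m), minusSq x y α γ s (φ m))) fun m =>
      ⟨⟨fun i => (hC.plus_mem _ i).1, fun i => (hC.minus_mem _ i).1⟩,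
        ⟨fun i => (hC.plus_mem _ i).2, fun i => (hC.minus_mem _ i).2⟩⟩
  have hp : ∀ i, 0 < p i := fun i => (hC.lo_pos i).trans_le (hmem.1.1 i)
  have hr : ∀ i, 0 < r i := fun i => (hC.lo'_pos i).trans_le (hmem.1.2 i)
  have hlimp : ∀ i, Tendsto (fun m => plusSq x y α γ s (φ (ψ m)) i) atTop (𝓝 (p i)) :=
    tendsto_pi_nhds.1 ((continuous_fst.tendsto _).comp hlim)
  have hlimr : ∀ i, Tendsto (fun m => minusSq x y α γ s (φ (ψ m)) i) atTop (𝓝 (r i)) :=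
    tendsto_pi_nhds.1 ((continuous_snd.tendsto _).comp hlim)
  have hpred := tendsto_predictor (φ := fun m => φ (ψ m)) hlimp hlimr
  have hz : (WithLp.toLp 2 fun i => (p i - r i) / 2 : Vec d) ∈ interpolators x y := by
    refine mem_interpolators_of_totalLoss_eq_zero hb hbn ?_
    refine tendsto_nhds_unique (((continuous_totalLoss b).tendsto _).comp hpred) ?_
    refine squeeze_zero (fun m => totalLoss_nonneg b _) (fun m => (hφlt (ψ m)).le) ?_
    exact tendsto_one_div_add_atTop_nhds_zero_nat.comp hψ.tendsto_atTop
  -- The reference is now the cluster point itself, so monotonicity upgrades subsequential to full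
  -- convergence.
  set V : ℕ → ℝ := fun k => lyapunov p r (plusSq x y α γ s k) (minusSq x y α γ s k) with hV
  have hV0 : ∀ k, 0 ≤ V k := fun k => lyapunov_nonneg hp hr (hC.plus_pos k) (hC.minus_pos k)
  have hanti : Antitone V := antitone_nat_of_succ_le fun k => by
    have h := lyapunov_succ_le hL hs hp hr hz (hγ k) (hγR k) hmem.2.1 hmem.2.2 (hC.plus_pos k)
      (hC.minus_pos k) (fun i => (hC.plus_mem k i).2) (fun i => (hC.minus_mem k i).2)
      (hC.abs_scaledGrad_le k)
    have := mul_nonneg (hγ k)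
      (batchLoss_nonneg (x := x) (y := y) (s k) (predictor x y α γ s k))
    change lyapunov _ _ _ _ ≤ lyapunov _ _ _ _
    linarith
  have hsub : Tendsto (fun m => V (φ (ψ m))) atTop (𝓝 0) := by
    have hent : ∀ {c : ℝ} {a : ℕ → ℝ}, 0 < c → Tendsto a atTop (𝓝 c) →
        Tendsto (fun m => relEnt c (a m)) atTop (𝓝 0) := by
      intro c a hc ha
      have h1 : ContinuousAt (relEnt c) c := by
        unfold relEnt
        refine ((continuousAt_const.mul (ContinuousAt.log ?_ ?_)).sub continuousAt_const).add
          continuousAt_id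
        · exact continuousAt_const.div continuousAt_id hc.ne'
        · exact (div_pos hc hc).ne'
      have h2 : relEnt c c = 0 := by simp [relEnt, hc.ne']
      simpa [h2, Function.comp_def] using h1.tendsto.comp ha
    have h := tendsto_finsetSum Finset.univ fun i _ =>
      (hent (hp i) (hlimp i)).add (hent (hr i) (hlimr i))
    simpa [hV, lyapunov] using h
  have hVlim : Tendsto V atTop (𝓝 0) := by
    have h := tendsto_atTop_ciInf hanti ⟨0, Set.forall_mem_range.2 hV0⟩
    have h2 := h.comp (hφ.comp hψ).tendsto_atTop
    rwa [tendsto_nhds_unique h2 hsub] at h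
  refine ⟨p, r, hp, hr, hz, fun i => ?_, fun i => ?_⟩
  · refine tendsto_of_relEnt_tendsto_zero (hp i) (fun k => hC.plus_pos k i)
      (squeeze_zero (fun k => relEnt_nonneg (hp i) (hC.plus_pos k i)) (fun k => ?_) hVlim)
    have := relEnt_add_le_lyapunov hp hr (hC.plus_pos k) (hC.minus_pos k) i
    have h2 := relEnt_nonneg (hr i) (hC.minus_pos k i)
    change _ ≤ lyapunov _ _ _ _
    linarith
  · refine tendsto_of_relEnt_tendsto_zero (hr i) (fun k => hC.minus_pos k i)
      (squeeze_zero (fun k => relEnt_nonneg (hr i) (hC.minus_pos k i)) (fun k => ?_) hVlim)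
    have := relEnt_add_le_lyapunov hp hr (hC.plus_pos k) (hC.minus_pos k) i
    have h2 := relEnt_nonneg (hp i) (hC.plus_pos k i)
    change _ ≤ lyapunov _ _ _ _
    linarith

/-- Each factor is `(1 - g)² = exp(-2g - qPlus g)`. -/
theorem plusSq_eq (hC : IsControlled x y α γ s lo lo' R E) (k : ℕ) (i : Fin d) :
    plusSq x y α γ s k i = α i ^ 2 *
      Real.exp (-∑ j ∈ Finset.range k, qPlus (scaledGrad x y α γ s j i)
        - 2 * ∑ j ∈ Finset.range k, scaledGrad x y α γ s j i) := by
  induction k with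
  | zero => simp [plusSq_zero]
  | succ k ih =>
    have h : 0 < (1 - scaledGrad x y α γ s k i) ^ 2 :=
      pow_pos (by linarith [(abs_le.1 (hC.abs_scaledGrad_le k i)).2]) 2
    rw [plusSq_succ, ih, Finset.sum_range_succ, Finset.sum_range_succ, mul_assoc]
    have hexp : ∀ S T t : ℝ, 0 < (1 - t) ^ 2 → Real.exp (-(S + qPlus t) - 2 * (T + t))
        = Real.exp (-S - 2 * T) * (1 - t) ^ 2 := fun S T t ht => by
      rw [← Real.exp_log ht, ← Real.exp_add, qPlus]
      congr 1
      ring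
    rw [hexp _ _ _ h]

theorem minusSq_eq (hC : IsControlled x y α γ s lo lo' R E) (k : ℕ) (i : Fin d) :
    minusSq x y α γ s k i = α i ^ 2 *
      Real.exp (-∑ j ∈ Finset.range k, qMinus (scaledGrad x y α γ s j i)
        + 2 * ∑ j ∈ Finset.range k, scaledGrad x y α γ s j i) := by
  induction k with
  | zero => simp [minusSq_zero]
  | succ k ih =>
    have h : 0 < (1 + scaledGrad x y α γ s k i) ^ 2 :=
      pow_pos (by linarith [(abs_le.1 (hC.abs_scaledGrad_le k i)).1]) 2
    rw [minusSq_succ, ih, Finset.sum_range_succ, Finset.sum_range_succ, mul_assoc]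
    have hexp : ∀ S T t : ℝ, 0 < (1 + t) ^ 2 → Real.exp (-(S + qMinus t) + 2 * (T + t))
        = Real.exp (-S + 2 * T) * (1 + t) ^ 2 := fun S T t ht => by
      rw [← Real.exp_log ht, ← Real.exp_add, qMinus]
      congr 1
      ring
    rw [hexp _ _ _ h]

/-- The implicit bias of a controlled trajectory whose squared coordinates converge. -/
theorem implicit_bias (hC : IsControlled x y α γ s lo lo' R E) (hα : ∀ i, 0 < α i)
    (hsq : ∀ i, Summable fun k => scaledGrad x y α γ s k i ^ 2)
    {p r : Fin d → ℝ} (hp : ∀ i, 0 < p i)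
    (hz : (WithLp.toLp 2 fun i => (p i - r i) / 2 : Vec d) ∈ interpolators x y)
    (hlimp : ∀ i, Tendsto (fun k => plusSq x y α γ s k i) atTop (𝓝 (p i)))
    (hlimr : ∀ i, Tendsto (fun k => minusSq x y α γ s k i) atTop (𝓝 (r i))) :
    ∃ βlim αinf βtilde : Vec d,
      βlim ∈ interpolators x y ∧
      Tendsto (predictor x y α γ s) atTop (𝓝 βlim) ∧
      argminOn (fun β => bregman (hypEntropy αinf) β βtilde) (interpolators x y) = {βlim} ∧
      (∀ i, Summable (fun k => q (scaledGrad x y α γ s k i)) ∧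
        Summable (fun k => qPlus (scaledGrad x y α γ s k i)) ∧
        Summable (fun k => qMinus (scaledGrad x y α γ s k i))) ∧
      (∀ i, 0 < αinf i ∧ αinf i ≤ α i ∧
        αinf i ^ 2 = effectiveSq q α (scaledGrad x y α γ s) i) ∧
      (∀ i, βtilde i = 1 / 2 * (effectiveSq qPlus α (scaledGrad x y α γ s) i
        - effectiveSq qMinus α (scaledGrad x y α γ s) i)) := by
  set g := scaledGrad x y α γ s with hg
  have hP := hC.summable_qPlus hsq
  have hM := hC.summable_qMinus hsq
  have hqeq : ∀ k i, q (g k i) = (qPlus (g k i) + qMinus (g k i)) / 2 := fun k i =>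
    q_eq (hC.abs_scaledGrad_le k i)
  have hQ : ∀ i, HasSum (fun k => q (g k i))
      ((∑' k, qPlus (g k i) + ∑' k, qMinus (g k i)) / 2) := fun i => by
    simp only [hqeq]
    exact ((hP i).hasSum.add (hM i).hasSum).div_const 2
  have hα2 : ∀ i, 0 < α i ^ 2 := fun i => pow_pos (hα i) 2
  have heff : ∀ i, 0 < effectiveSq q α g i := fun i => mul_pos (hα2 i) (Real.exp_pos _)
  let αinf : Vec d := WithLp.toLp 2 fun i => √(effectiveSq q α g i)
  let βtilde : Vec d := WithLp.toLp 2 fun i =>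
    1 / 2 * (effectiveSq qPlus α g i - effectiveSq qMinus α g i)
  let βlim : Vec d := WithLp.toLp 2 fun i => (p i - r i) / 2
  have hαpos : ∀ i, 0 < αinf i := fun i => Real.sqrt_pos.2 (heff i)
  have hαsq : ∀ i, αinf i ^ 2 = effectiveSq q α g i := fun i => Real.sq_sqrt (heff i).le
  -- Square-summability alone would not give this; convergence is read off from the limit of
  -- `plusSq`, and only for partial sums.
  have hG : ∀ i, ∃ G, Tendsto (fun k => ∑ j ∈ Finset.range k, g j i) atTop (𝓝 G) := by
    intro i
    have h1 : ∀ k, ∑ j ∈ Finset.range k, g j i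
        = (-∑ j ∈ Finset.range k, qPlus (g j i)
          - Real.log (plusSq x y α γ s k i / α i ^ 2)) / 2 := by
      intro k
      rw [hC.plusSq_eq, mul_div_cancel_left₀ _ (hα2 i).ne', Real.log_exp]
      ring
    simp only [h1]
    exact ⟨_, (((hP i).hasSum.tendsto_sum_nat.neg).sub
      (((hlimp i).div_const _).log (div_pos (hp i) (hα2 i)).ne')).div_const 2⟩
  choose G hG using hG
  have hpG : ∀ i, p i = α i ^ 2 * Real.exp (-(∑' k, qPlus (g k i)) - 2 * G i) := fun i => by
    refine tendsto_nhds_unique (hlimp i) ?_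
    simp only [hC.plusSq_eq]
    exact (((hP i).hasSum.tendsto_sum_nat.neg.sub ((hG i).const_mul 2)).rexp).const_mul _
  have hrG : ∀ i, r i = α i ^ 2 * Real.exp (-(∑' k, qMinus (g k i)) + 2 * G i) := fun i => by
    refine tendsto_nhds_unique (hlimr i) ?_
    simp only [hC.minusSq_eq]
    exact (((hM i).hasSum.tendsto_sum_nat.neg.add ((hG i).const_mul 2)).rexp).const_mul _
  -- Factoring out the geometric mean of the two exponentials, which is the scale `αinf²`, leaves a
  -- `sinh`. The case `t = 0` handles `βtilde`.
  have hsinh : ∀ (c A B t : ℝ), c ≠ 0 →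
      (c * Real.exp (-A - 2 * t) - c * Real.exp (-B + 2 * t)) / 2
        / (c * Real.exp (-((A + B) / 2))) = Real.sinh ((B - A) / 2 - 2 * t) := by
    intro c A B t hc
    have h1 : Real.exp (-A - 2 * t)
        = Real.exp (-((A + B) / 2)) * Real.exp ((B - A) / 2 - 2 * t) := by
      rw [← Real.exp_add]; ring_nf
    have h2 : Real.exp (-B + 2 * t)
        = Real.exp (-((A + B) / 2)) * Real.exp (-((B - A) / 2 - 2 * t)) := by
      rw [← Real.exp_add]; ring_nf
    rw [h1, h2, Real.sinh_eq]
    have := Real.exp_pos (-((A + B) / 2))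
    field_simp
  have hlim_arsinh : ∀ i, Real.arsinh (βlim i / αinf i ^ 2)
      = (∑' k, qMinus (g k i) - ∑' k, qPlus (g k i)) / 2 - 2 * G i := fun i => by
    rw [hαsq, effectiveSq, (hQ i).tsum_eq]
    change Real.arsinh ((p i - r i) / 2 / _) = _
    rw [hpG, hrG, hsinh _ _ _ _ (hα2 i).ne', Real.arsinh_sinh]
  have htilde_arsinh : ∀ i, Real.arsinh (βtilde i / αinf i ^ 2)
      = (∑' k, qMinus (g k i) - ∑' k, qPlus (g k i)) / 2 := fun i => by
    have h := hsinh (α i ^ 2) (∑' k, qPlus (g k i)) (∑' k, qMinus (g k i)) 0 (hα2 i).ne'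
    simp only [mul_zero, sub_zero, add_zero] at h
    rw [hαsq, effectiveSq, (hQ i).tsum_eq]
    change Real.arsinh (1 / 2 * (effectiveSq qPlus α g i - effectiveSq qMinus α g i) / _) = _
    rw [effectiveSq, effectiveSq, one_div, ← div_eq_inv_mul, h, Real.arsinh_sinh]
  refine ⟨βlim, αinf, βtilde, hz, tendsto_predictor (φ := id) hlimp hlimr, ?_,
    fun i => ⟨(hQ i).summable, hP i, hM i⟩, fun i => ⟨hαpos i, ?_, hαsq i⟩, fun i => rfl⟩
  · refine argminOn_bregman_hypEntropy hαpos hz fun w hw => ?_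
    have h1 : ∀ k, ∑ i, (∑ j ∈ Finset.range k, g j i) * (w - βlim) i = 0 := by
      intro k
      have h2 : ∀ j, ∑ i, g j i * (w - βlim) i = 0 := by
        intro j
        have h3 := inner_batchGrad_sub_eq_zero (s j) (predictor x y α γ s j) hw hz
        have h4 : inner ℝ (g j) (w - βlim) = 0 := by
          rw [hg, scaledGrad_eq, inner_smul_left, h3, mul_zero]
        rw [PiLp.inner_apply] at h4
        rw [← h4]
        refine Finset.sum_congr rfl fun i _ => ?_
        simp [mul_comm]
      simp only [Finset.sum_mul]
      rw [Finset.sum_comm]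
      exact Finset.sum_eq_zero fun j _ => h2 j
    have h5 : ∑ i, G i * (w - βlim) i = 0 := by
      refine tendsto_nhds_unique (tendsto_finsetSum Finset.univ fun i _ =>
        (hG i).mul_const ((w - βlim) i)) ?_
      simp only [h1]
      exact tendsto_const_nhds
    rw [inner_sub_left, inner_gradient_hypEntropy hαpos, inner_gradient_hypEntropy hαpos,
      ← Finset.sum_sub_distrib, ← neg_eq_zero, ← h5, ← Finset.sum_neg_distrib]
    refine Finset.sum_congr rfl fun i _ => ?_
    rw [hlim_arsinh, htilde_arsinh]
    ring
  · refine Real.sqrt_le_iff.2 ⟨(hα i).le, mul_le_of_le_one_right (hα2 i).le ?_⟩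
    rw [Real.exp_le_one_iff, neg_nonpos]
    refine tsum_nonneg fun k => ?_
    rw [hqeq]
    have h1 := (qPlus_mem_Icc (hC.abs_scaledGrad_le k i)).1
    have h2 := (qMinus_mem_Icc (hC.abs_scaledGrad_le k i)).1
    change 0 ≤ (qPlus (scaledGrad x y α γ s k i) + qMinus (scaledGrad x y α γ s k i)) / 2
    linarith

end IsControlled

end Convergence

end DLN

/-! ### Averaging over the random batches -/

namespace DLN

section Sampling

variable {n d b : ℕ} {Ω : Type*} [MeasurableSpace Ω] {P : Measure Ω} {batch : ℕ → Ω → Batch n b}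

theorem Batch.idx_injective : Function.Injective (Batch.idx : Batch n b → Finset (Fin n)) := by
  rintro ⟨s, hs⟩ ⟨t, ht⟩ (rfl : s = t)
  rfl

instance instFiniteBatch (n b : ℕ) : Finite (Batch n b) :=
  Finite.of_injective _ Batch.idx_injective

/-- A function of the batch sequence that depends on the first `k` batches only factors through
these. -/
theorem exists_eq_comp_past {β Ω : Type*} {batch : ℕ → Ω → Batch n b} {k : ℕ}
    {F : (ℕ → Finset (Fin n)) → β}
    (hF : ∀ s s', (∀ j < k, s j = s' j) → F s = F s') :
    ∃ Φ : (Finset.range k → Batch n b) → β, ∀ ω,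
      F (fun j => (batch j ω).idx) = Φ fun j => batch j ω := by
  -- The value `∅` from time `k` on is arbitrary, since `F` ignores it.
  refine ⟨fun t => F fun j => if h : j ∈ Finset.range k then (t ⟨j, h⟩).idx else ∅,
    fun ω => hF _ _ fun j hj => ?_⟩
  simp [hj]

theorem measurable_of_past (hU : IsUniformSampling P batch) {k : ℕ}
    {F : (ℕ → Finset (Fin n)) → ENNReal} (hF : ∀ s s', (∀ j < k, s j = s' j) → F s = F s') :
    Measurable fun ω => F fun j => (batch j ω).idx := by
  obtain ⟨Φ, hΦ⟩ := exists_eq_comp_past (batch := batch) hF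
  simp only [hΦ]
  exact (measurable_of_finite Φ).comp (measurable_pi_lambda _ fun j => hU.measurable j)

/-- Split according to the value `t` of the current batch: its indicator is independent of the past
and has probability `1 / n.choose b`. -/
theorem lintegral_current_batch (hU : IsUniformSampling P batch) {k : ℕ}
    {F : Finset (Fin n) → (ℕ → Finset (Fin n)) → ENNReal}
    (hF : ∀ t s s', (∀ j < k, s j = s' j) → F t s = F t s') :
    ∫⁻ ω, F (batch k ω).idx (fun j => (batch j ω).idx) ∂P
      = ((n.choose b : ℕ) : ENNReal)⁻¹ * ∑ t ∈ Finset.powersetCard b Finset.univ,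
          ∫⁻ ω, F t (fun j => (batch j ω).idx) ∂P := by
  classical
  have hmeas : ∀ t, Measurable fun ω => F t fun j => (batch j ω).idx := fun t =>
    measurable_of_past hU (hF t)
  have hind : ∀ t : Finset (Fin n),
      Measurable fun B : Batch n b => if B.idx = t then (1 : ENNReal) else 0 := fun t =>
    measurable_of_finite _
  have hsplit : ∀ ω, F (batch k ω).idx (fun j => (batch j ω).idx)
      = ∑ t ∈ Finset.powersetCard b Finset.univ,
        F t (fun j => (batch j ω).idx) * (if (batch k ω).idx = t then 1 else 0) := by
    intro ω
    rw [Finset.sum_eq_single_of_mem (batch k ω).idx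
      (Finset.mem_powersetCard_univ.2 (batch k ω).card_idx)]
    · simp
    · intro t _ ht
      simp [ht.symm]
  have hcur : ∀ t, Measurable fun ω => if (batch k ω).idx = t then (1 : ENNReal) else 0 :=
    fun t => (hind t).comp (hU.measurable k)
  simp only [hsplit]
  rw [lintegral_finsetSum _ fun t _ =>
    (hmeas t).fun_mul (hcur t), Finset.mul_sum]
  refine Finset.sum_congr rfl fun t ht => ?_
  obtain ⟨Φ, hΦ⟩ := exists_eq_comp_past (batch := batch) (hF t)
  have hindep : IndepFun (fun ω => F t fun j => (batch j ω).idx)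
      (fun ω => if (batch k ω).idx = t then (1 : ENNReal) else 0) P := by
    have h := hU.indep.indepFun_finset (Finset.range k) {k} (by simp) hU.measurable
    have h2 := h.comp (measurable_of_finite Φ)
      ((hind t).comp (measurable_pi_apply (⟨k, Finset.mem_singleton_self k⟩ : ({k} : Finset ℕ))))
    simp only [hΦ]
    exact h2
  have hprob : ∫⁻ ω, (if (batch k ω).idx = t then (1 : ENNReal) else 0) ∂P
      = ((n.choose b : ℕ) : ENNReal)⁻¹ := by
    let B : Batch n b := ⟨t, Finset.mem_powersetCard_univ.1 ht⟩
    have hset : {ω | (batch k ω).idx = t} = {ω | batch k ω = B} :=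
      Set.ext fun ω => ⟨fun h => Batch.idx_injective (h.trans rfl), fun h => congrArg Batch.idx h⟩
    have hms : MeasurableSet {ω | batch k ω = B} := hU.measurable k (measurableSet_singleton B)
    have : (fun ω => if (batch k ω).idx = t then (1 : ENNReal) else 0)
        = Set.indicator {ω | (batch k ω).idx = t} 1 := by
      ext ω
      simp [Set.indicator_apply]
    rw [this, hset, lintegral_indicator_one hms, hU.uniform k B]
  rw [← hprob, mul_comm (∫⁻ ω, _ ∂P)]
  exact lintegral_mul_eq_lintegral_mul_lintegral_of_indepFun (hmeas t)
    (hcur t) hindep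

/-- The energy bound holds for each realisation, hence in expectation; replacing the drawn batch by
the sum over all batches only costs the factor `n.choose b`, and a finite expectation forces almost
sure finiteness. -/
theorem ae_summable_totalLoss [IsProbabilityMeasure P] {x : Fin n → Vec d} {y : Fin n → ℝ}
    {α : Vec d} {γ : ℕ → ℝ} {E : ℝ} (hγ : ∀ k, 0 ≤ γ k) (hU : IsUniformSampling P batch)
    (hE : ∀ ω N, ∑ k ∈ Finset.range N, γ k * batchLoss x y (batch k ω).idx
      (predictor x y α γ (fun j => (batch j ω).idx) k) ≤ E) :
    ∀ᵐ ω ∂P, Summable fun k =>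
      γ k * totalLoss x y b (predictor x y α γ (fun j => (batch j ω).idx) k) := by
  let F : ℕ → Finset (Fin n) → (ℕ → Finset (Fin n)) → ENNReal := fun k t s =>
    ENNReal.ofReal (γ k * batchLoss x y t (predictor x y α γ s k))
  have hF : ∀ k t s s', (∀ j < k, s j = s' j) → F k t s = F k t s' := by
    intro k t s s' h
    simp only [F, predictor, sgd_congr x y α γ k h]
  have hmeas : ∀ k t, Measurable fun ω => F k t fun j => (batch j ω).idx := fun k t =>
    measurable_of_past hU (hF k t)
  have hmeas_cur : ∀ k, Measurable fun ω => F k (batch k ω).idx fun j => (batch j ω).idx := by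
    intro k
    let F' : (ℕ → Finset (Fin n)) → ENNReal := fun s => F k (s k) s
    refine measurable_of_past (k := k + 1) (F := F') hU fun s s' h => ?_
    simp only [F']
    rw [h k k.lt_succ_self, hF k _ s s' fun j hj => h j (hj.trans k.lt_succ_self)]
  have htot : ∀ k ω, ENNReal.ofReal
      (γ k * totalLoss x y b (predictor x y α γ (fun j => (batch j ω).idx) k))
      = ∑ t ∈ Finset.powersetCard b Finset.univ, F k t fun j => (batch j ω).idx := by
    intro k ω
    rw [totalLoss, Finset.mul_sum,
      ENNReal.ofReal_sum_of_nonneg fun t _ => mul_nonneg (hγ k) (batchLoss_nonneg _ _)]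
  -- A probability space is nonempty, so some batch of size `b` exists and `b ≤ n`.
  have hchoose : ((n.choose b : ℕ) : ENNReal) ≠ 0 := by
    obtain ⟨ω⟩ := nonempty_of_isProbabilityMeasure P
    have : (batch 0 ω).idx.card ≤ n := by simpa using (batch 0 ω).idx.card_le_univ
    rw [(batch 0 ω).card_idx] at this
    exact_mod_cast (Nat.choose_pos this).ne'
  have hint : ∀ k, ∑ t ∈ Finset.powersetCard b Finset.univ,
        ∫⁻ ω, F k t (fun j => (batch j ω).idx) ∂P
      = ((n.choose b : ℕ) : ENNReal) * ∫⁻ ω, F k (batch k ω).idx (fun j => (batch j ω).idx) ∂P := by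
    intro k
    rw [lintegral_current_batch hU (hF k), ← mul_assoc,
      ENNReal.mul_inv_cancel hchoose (ENNReal.natCast_ne_top _), one_mul]
  have hbound : ∀ ω, ∑' k, F k (batch k ω).idx (fun j => (batch j ω).idx) ≤ ENNReal.ofReal E := by
    intro ω
    refine ENNReal.tsum_le_of_sum_range_le fun N => ?_
    rw [← ENNReal.ofReal_sum_of_nonneg fun k _ => mul_nonneg (hγ k) (batchLoss_nonneg _ _)]
    exact ENNReal.ofReal_le_ofReal (hE ω N)
  have hfin : ∫⁻ ω, ∑' k, ∑ t ∈ Finset.powersetCard b Finset.univ,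
      F k t (fun j => (batch j ω).idx) ∂P ≠ ⊤ := by
    rw [lintegral_tsum fun k => (Finset.measurable_fun_sum _ fun t _ => hmeas k t).aemeasurable]
    simp only [lintegral_finsetSum _ fun t _ => hmeas _ t, hint]
    rw [ENNReal.tsum_mul_left, ← lintegral_tsum fun k => (hmeas_cur k).aemeasurable]
    refine ENNReal.mul_ne_top (ENNReal.natCast_ne_top _) (ne_top_of_le_ne_top ?_
      (lintegral_mono hbound))
    simp
  have hae := ae_lt_top (Measurable.tsum fun k =>
    Finset.measurable_fun_sum _ fun t _ => hmeas k t) hfin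
  filter_upwards [hae] with ω hω
  simp only [← htot] at hω
  refine (ENNReal.summable_toReal hω.ne).congr fun k => ?_
  exact ENNReal.toReal_ofReal (mul_nonneg (hγ k) (totalLoss_nonneg b _))

end Sampling

end DLN

/-! ### Assembly -/

theorem theorem1 :
    (∀ z : ℝ, |z| ≤ √2 → 0 ≤ q z) ∧
    ∃ c : ℝ, 0 < c ∧
      ∀ (n d : ℕ) (x : Fin n → Vec d) (y : Fin n → ℝ) (α : Vec d),
        (∀ i, 0 < α i) → (interpolators x y).Nonempty →
      ∃ B : ℝ, 0 < B ∧
        ∀ (b : ℕ), 1 ≤ b → b ≤ n →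
        ∀ (L : ℝ), 0 < L → IsSmoothnessConstant x b L →
        ∀ (γ : ℕ → ℝ), (∀ k, 0 ≤ γ k) → (∀ k, γ k ≤ c / (L * B)) →
        ∀ (Ω : Type*) [MeasurableSpace Ω] (P : Measure Ω) [IsProbabilityMeasure P]
          (batch : ℕ → Ω → Batch n b), IsUniformSampling P batch →
          (∀ ω k,
            supNorm (scaledGrad x y α γ (fun j => (batch j ω).idx) k) < 1 ∧
            supNorm (predictor x y α γ (fun j => (batch j ω).idx) k) ≤ B) ∧
          (¬ Summable γ →
            ∀ᵐ ω ∂P, ∃ βlim αinf βtilde : Vec d, ∃ g : ℕ → Vec d,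
              (∀ k, g k = scaledGrad x y α γ (fun j => (batch j ω).idx) k) ∧
              βlim ∈ interpolators x y ∧
              Tendsto (predictor x y α γ (fun j => (batch j ω).idx)) atTop (𝓝 βlim) ∧
              argminOn (fun β => bregman (hypEntropy αinf) β βtilde) (interpolators x y)
                = {βlim} ∧
              (∀ i, Summable (fun k => q (g k i)) ∧ Summable (fun k => qPlus (g k i)) ∧
                Summable (fun k => qMinus (g k i))) ∧
              (∀ i, 0 < αinf i ∧ αinf i ≤ α i ∧ αinf i ^ 2 = effectiveSq q α g i) ∧
              (∀ i, βtilde i = 1 / 2 * (effectiveSq qPlus α g i - effectiveSq qMinus α g i))) := by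
  -- With `c = 1 / 10` and `B = R`, the stepsize condition is exactly `γ k * L * R ≤ 1 / 10`.
  refine ⟨fun z hz => q_nonneg hz, 1 / 10, by norm_num, fun n d x y α hα hne => ?_⟩
  obtain ⟨lo, lo', R, E, hR, hctrl⟩ := exists_isControlled hα hne
  refine ⟨R, hR, fun b hb hbn L hL0 hL γ hγ hγc Ω _ P _ batch hU => ?_⟩
  have hγR : ∀ k, γ k * L * R ≤ 1 / 10 := fun k => by
    rw [mul_assoc]
    exact (le_div_iff₀ (mul_pos hL0 hR)).1 (hγc k)
  have hs : ∀ ω k, ((batch k ω).idx).card = b := fun ω k => (batch k ω).card_idx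
  have hC := fun ω => hctrl b L hL0 hL γ hγ hγR (fun j => (batch j ω).idx) (hs ω)
  refine ⟨fun ω k => ⟨((hC ω).supNorm_scaledGrad k).trans_lt (by norm_num),
    (hC ω).supNorm_predictor_le hR.le k⟩, fun hns => ?_⟩
  filter_upwards [ae_summable_totalLoss hγ hU fun ω => (hC ω).energy] with ω hω
  obtain ⟨p, r, hp, -, hz, hlimp, hlimr⟩ :=
    (hC ω).tendsto hL (hs ω) hγ hγR hb hbn hns hω
  obtain ⟨βlim, αinf, βtilde, h⟩ := (hC ω).implicit_bias hα
    ((hC ω).summable_sq hL (hs ω) hne hR hγ hγR) hp hz hlimp hlimr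
  exact ⟨βlim, αinf, βtilde, _, fun _ => rfl, h⟩
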